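/- **Setting.** Let $N\ge 1$, $n=N^2$, $\mathbf I=\{\frac1N,\dots,\frac{N-1}N,1\}^2$, and let $Y(x)=f(x)+\varepsilon(x)$, $x\in\mathbf I$, where $f$ is an unknown real function and the $\varepsilon(x)$ are i.i.d. $N(0,\sigma^2)$, $\sigma>0$. For a pixel $x\in\mathbf I$ and $r>0$ let $W_{x,r}=\{y\in\mathbf I:\|y-x\|_\infty\le r\}$. Fix $x_0\in\mathbf I$ and $h,\eta>0$; write $\mathbf U_{x_0,h}=W_{x_0,h}$ (search window) and $\mathbf V_{x,\eta}=W_{x,\eta}$ (patch window), and suppose that no patch window $\mathbf V_{x,\eta}$, $x\in\mathbf U_{x_0,h}$, is cut off by the border of the image. Split $\mathbf I$ into $\mathbf I'=\{x_0+(\frac iN,\frac jN)\in\mathbf I: i+j\text{ even}\}$ and $\mathbf I''=\mathbf I\setminus\mathbf I'$, and put $\mathbf U'=\mathbf U_{x_0,h}\cap\mathbf I'$, $\mathbf V''_x=\mathbf V_{x,\eta}\cap\mathbf I''$, $m''_x=\operatorname{card}\mathbf V''_x$. For $x\in\mathbf U'$ let $$\widehat\rho''(x)=\Big(\Big(\frac1{m''_x}\sum_{y\in\mathbf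 V''_{x_0}}\big(Y(x+(y-x_0))-Y(y)\big)^2\Big)^{1/2}-\sqrt2\,\sigma\Big)^+ .$$ The split-sample Optimal Weights Filter is $$\widehat f'_{h,\eta}(x_0)=\sum_{x\in\mathbf U'}\widehat w''(x)Y(x),\qquad \widehat w''=\arg\min_w\Big(\sum_{x\in\mathbf U'}w(x)\widehat\rho''(x)\Big)^2+\sigma^2\sum_{x\in\mathbf U'}w(x)^2,$$ the minimum being over all $w\ge0$ on $\mathbf U'$ with $\sum_{x\in\mathbf U'}w(x)=1$ (the minimizer exists and is unique). **Theorem.** Let $\beta,L,\sigma,c_1,c_2>0$. There is a constant $C>0$, depending only on these five numbers, such that for every $\alpha$ with $0<\alpha\le\frac1{2\beta+2}$ the following holds for all sufficiently large $n=N^2$ (how large may depend on $\alpha$ and on the five numbers only). Let $h=c_1n^{-\alpha}$ and $\eta=c_2n^{-\frac1{2\beta+2}}$, let $x_0$ be as above, and suppose that $f$ satisfies the local Hölder condition $$|f(x)-f(y)|\le L\|x-y\|_\infty^\beta\qquad\text{for all }x,y\in\mathbf U_{x_0,h};$$ in the borderline case $\alpha=\frac1{2\beta+2}$ suppose moreover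 that $c_2<c_1$ (the patch is smaller than the search window) or that the Hölder condition holds for all $x,y\in\mathbf U_{x_0,h+\eta}$. Then $\widehat f'_{h,\eta}(x_0)$ has a finite second moment and $$\mathbb E\big(\widehat f'_{h,\eta}(x_0)-f(x_0)\big)^2\le C\,n^{-\frac{\beta}{2\beta+2}}\ln n .$$ -/

import Mathlib

open MeasureTheory ProbabilityTheory

noncomputable section

namespace OWF

/-- A pixel is given by its integer coordinates `(i, j)`; `pos N (i, j) = (i / N, j / N)` is the
corresponding point of the plane. The norm of `ℝ × ℝ` is the supremum norm. -/
def pos (N : ℕ) (p : ℤ × ℤ) : ℝ × ℝ := ((p.1 : ℝ) / N, (p.2 : ℝ) / N)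

/-- The uniform `N × N` grid `{1/N, …, 1}²`. -/
def grid (N : ℕ) : Finset (ℤ × ℤ) := Finset.Icc 1 (N : ℤ) ×ˢ Finset.Icc 1 (N : ℤ)

/-- The square window of pixels `{y ∈ I : ‖y - x‖_∞ ≤ r}`. For `r = h` it is the search window
`U_{x,h}`, for `r = η` the patch window `V_{x,η}`. -/
def window (N : ℕ) (x : ℤ × ℤ) (r : ℝ) : Finset (ℤ × ℤ) :=
  (grid N).filter fun y => ‖pos N y - pos N x‖ ≤ r

/-- `I'_{x₀}`: the pixels `x₀ + (i/N, j/N)` with `i + j` even. -/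
def evenPixels (N : ℕ) (x₀ : ℤ × ℤ) : Finset (ℤ × ℤ) :=
  (grid N).filter fun y => Even ((y.1 - x₀.1) + (y.2 - x₀.2))

/-- `I''_{x₀} = I \ I'_{x₀}`. -/
def oddPixels (N : ℕ) (x₀ : ℤ × ℤ) : Finset (ℤ × ℤ) := grid N \ evenPixels N x₀

/-- `U'_{x₀,h} = U_{x₀,h} ∩ I'_{x₀}`. -/
def searchEven (N : ℕ) (x₀ : ℤ × ℤ) (h : ℝ) : Finset (ℤ × ℤ) := window N x₀ h ∩ evenPixels N x₀

/-- `V''_{x,η} = V_{x,η} ∩ I''_{x₀}`. -/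
def patchOdd (N : ℕ) (x₀ x : ℤ × ℤ) (η : ℝ) : Finset (ℤ × ℤ) := window N x η ∩ oddPixels N x₀

/-- Every patch window centred in the search window `U_{x₀,h}` lies in the image, i.e. no patch
is cut off by the border of the image, so that all data patches have the same shape. -/
def PatchesInside (N : ℕ) (x₀ : ℤ × ℤ) (h η : ℝ) : Prop :=
  ∀ x ∈ window N x₀ h, ∀ z : ℤ × ℤ, ‖pos N z‖ ≤ η → x + z ∈ grid N

/-- Hölder condition with exponent `β` and constant `L` on a set of pixels. -/
def HolderOnPixels (N : ℕ) (f : ℝ × ℝ → ℝ) (β L : ℝ) (s : Finset (ℤ × ℤ)) : Prop :=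
  ∀ x ∈ s, ∀ y ∈ s, |f (pos N x) - f (pos N y)| ≤ L * ‖pos N x - pos N y‖ ^ β

/-- The noise `ε(x)`, `x ∈ I`, is i.i.d. Gaussian with mean `0` and standard deviation `σ`. -/
def IsGaussianNoise {Ω : Type*} [MeasurableSpace Ω] (N : ℕ) (σ : ℝ) (ε : ℤ × ℤ → Ω → ℝ)
    (μ : Measure Ω) : Prop :=
  (∀ p ∈ grid N, HasLaw (ε p) (gaussianReal 0 (σ ^ 2).toNNReal) μ) ∧
    iIndepFun (fun p : {p : ℤ × ℤ // p ∈ grid N} => ε p) μ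

/-- The observed image `Y(x) = f(x) + ε(x)`. -/
def observe {Ω : Type*} (N : ℕ) (f : ℝ × ℝ → ℝ) (ε : ℤ × ℤ → Ω → ℝ) (ω : Ω) (p : ℤ × ℤ) : ℝ :=
  f (pos N p) + ε p ω

/-- The distance `d(Y''_{x,η}, Y''_{x₀,η})` between the data patches at `x` and `x₀`, which are
matched by the translation `y ↦ x + (y - x₀)`. -/
def patchDist (N : ℕ) (Y : ℤ × ℤ → ℝ) (x₀ : ℤ × ℤ) (η : ℝ) (x : ℤ × ℤ) : ℝ :=
  1 / √((patchOdd N x₀ x η).card : ℝ) *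
    √(∑ y ∈ patchOdd N x₀ x₀ η, (Y (x + (y - x₀)) - Y y) ^ 2)

/-- The estimated similarity `ρ̂''(x) = (d(Y''_{x,η}, Y''_{x₀,η}) - √2 σ)⁺`. -/
def rhoHat (N : ℕ) (σ : ℝ) (Y : ℤ × ℤ → ℝ) (x₀ : ℤ × ℤ) (η : ℝ) (x : ℤ × ℤ) : ℝ :=
  max (patchDist N Y x₀ η x - √2 * σ) 0

/-- The objective `g_ρ(w) = (∑ w(x) ρ(x))² + σ² ∑ w(x)²`. -/
def objective (s : Finset (ℤ × ℤ)) (σ : ℝ) (ρ : ℤ × ℤ → ℝ) (w : s → ℝ) : ℝ :=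
  (∑ x : s, w x * ρ x) ^ 2 + σ ^ 2 * ∑ x : s, w x ^ 2

/-- `w` minimizes `g_ρ` among the nonnegative weights on `s` with sum one. -/
def IsOptimalWeight (s : Finset (ℤ × ℤ)) (σ : ℝ) (ρ : ℤ × ℤ → ℝ) (w : s → ℝ) : Prop :=
  w ∈ stdSimplex ℝ s ∧ ∀ v ∈ stdSimplex ℝ s, objective s σ ρ w ≤ objective s σ ρ v

/-- The optimal weights exist and are unique. -/
theorem existsUnique_optimalWeight (s : Finset (ℤ × ℤ)) (hs : s.Nonempty) (σ : ℝ) (hσ : 0 < σ)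
    (ρ : ℤ × ℤ → ℝ) : ∃! w, IsOptimalWeight s σ ρ w := by
  obtain ⟨x, hx⟩ := hs
  obtain ⟨w, hw, hmin⟩ := (isCompact_stdSimplex ℝ s).exists_isMinOn
    ⟨_, single_mem_stdSimplex ℝ (⟨x, hx⟩ : s)⟩
    (f := objective s σ ρ) (by unfold objective; fun_prop)
  refine ⟨w, ⟨hw, fun v hv => hmin hv⟩, ?_⟩
  rintro v ⟨hv, hvmin⟩
  have hmid : (fun i => (1 / 2 : ℝ) * v i + (1 / 2) * w i) ∈ stdSimplex ℝ s :=
    convex_stdSimplex ℝ s hv hw (by norm_num) (by norm_num) (by norm_num)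
  have h1 := hvmin _ hmid
  have h2 := hvmin _ hw
  have h3 : objective s σ ρ w ≤ objective s σ ρ v := hmin hv
  have key : objective s σ ρ (fun i => (1 / 2 : ℝ) * v i + (1 / 2) * w i) =
      (objective s σ ρ v + objective s σ ρ w) / 2
        - (∑ i : s, v i * ρ i - ∑ i : s, w i * ρ i) ^ 2 / 4
        - σ ^ 2 * (∑ i : s, (v i - w i) ^ 2) / 4 := by
    have e1 : ∑ i : s, ((1 / 2 : ℝ) * v i + (1 / 2) * w i) * ρ i =
        (1 / 2) * ∑ i : s, v i * ρ i + (1 / 2) * ∑ i : s, w i * ρ i := by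
      rw [Finset.mul_sum, Finset.mul_sum, ← Finset.sum_add_distrib]
      exact Finset.sum_congr rfl fun i _ => by ring
    have e2 : ∑ i : s, ((1 / 2 : ℝ) * v i + (1 / 2) * w i) ^ 2 =
        (1 / 2) * ∑ i : s, v i ^ 2 + (1 / 2) * ∑ i : s, w i ^ 2
          - (1 / 4) * ∑ i : s, (v i - w i) ^ 2 := by
      rw [Finset.mul_sum, Finset.mul_sum, Finset.mul_sum, ← Finset.sum_add_distrib,
        ← Finset.sum_sub_distrib]
      exact Finset.sum_congr rfl fun i _ => by ring
    unfold objective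
    rw [e1, e2]
    ring
  have hsum : ∑ i : s, (v i - w i) ^ 2 = 0 := by
    have h0 : 0 ≤ ∑ i : s, (v i - w i) ^ 2 := Finset.sum_nonneg fun i _ => sq_nonneg _
    have h4 : σ ^ 2 * ∑ i : s, (v i - w i) ^ 2 ≤ 0 := by
      nlinarith [sq_nonneg (∑ i : s, v i * ρ i - ∑ i : s, w i * ρ i)]
    have h5 : 0 < σ ^ 2 := by positivity
    nlinarith
  rw [Finset.sum_eq_zero_iff_of_nonneg fun i _ => sq_nonneg _] at hsum
  funext i
  have := hsum i (Finset.mem_univ i)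
  nlinarith [pow_eq_zero_iff (two_ne_zero) |>.mp this]

/-- The optimal weights `arg min g_ρ` (the unique minimizer when `s` is nonempty and `σ > 0`). -/
def optimalWeight (s : Finset (ℤ × ℤ)) (σ : ℝ) (ρ : ℤ × ℤ → ℝ) : s → ℝ :=
  Classical.epsilon (IsOptimalWeight s σ ρ)

theorem optimalWeight_spec (s : Finset (ℤ × ℤ)) (hs : s.Nonempty) (σ : ℝ) (hσ : 0 < σ)
    (ρ : ℤ × ℤ → ℝ) : IsOptimalWeight s σ ρ (optimalWeight s σ ρ) :=
  Classical.epsilon_spec (existsUnique_optimalWeight s hs σ hσ ρ).exists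

/-- The split-sample Optimal Weights Filter
`f̂'_{h,η}(x₀) = ∑_{x ∈ U'_{x₀,h}} ŵ''(x) Y(x)`, where `ŵ''` are the optimal weights for `ρ̂''`. -/
def splitFilter (N : ℕ) (σ h η : ℝ) (Y : ℤ × ℤ → ℝ) (x₀ : ℤ × ℤ) : ℝ :=
  ∑ x : searchEven N x₀ h,
    optimalWeight (searchEven N x₀ h) σ (rhoHat N σ Y x₀ η) x * Y x

end OWF

end

noncomputable section

namespace OWF

open scoped ENNReal NNReal

/-! The weights depend only on the noise at odd pixels, while the averaged values carry the noise at
even pixels. Given the weights, the noise part of the error therefore has second moment `σ² ∑ w²`,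
and the risk is at most twice the mean of squared bias plus this variance
(`integrable_and_integral_sq_error_le`).

Write `S` for the sum of squares in the patch distance, `D` for its noiseless counterpart and `m`
for the number of odd patch pixels. Outside an event of probability at most `2 / N²`, every `x ≠ x₀`
satisfies `m (2σ² - t) + D / 2 < S < m (2σ² + t) + 2 D`, with `t` of order `√(ln n / m)`
(`measure_patchSqSum_deviation_le`). The differences `ε(x + (y - x₀)) - ε(y)` are dependent along
chains of step `x - x₀`. A two-colouring makes them independent within each colour, and
Cauchy–Schwarz joins the two Laplace transforms.

The sandwich is used in both directions. For `x` within `δ` of `x₀`, with `δ` of order `n ^ (-1 /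
(2β + 2))`, the Hölder condition makes `D` small, so `ρ̂''` is at most `b`, of order `t + δ ^ (2β)`.
Uniform weights on these points show that the minimal objective is at most `A = b² + σ² / card`
(`IsOptimalWeight.objective_le`). Conversely, the lower half gives `(f x - f x₀)² ≤ K₁ ρ̂''(x) + K₂`
at every `x` of the search set (`sq_sub_le`), even though `f` may be arbitrary on the parts of
patches outside the search window. By convexity the squared bias is at most `K₁ ∑ w ρ̂'' + K₂ ≤ K₁
√A + K₂`.

With `u = n ^ (-β / (2β + 2))`, both `δ ^ β` and `1 / (δ N)` are of order `u`, and `t` is of order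
`u √(ln n)`. Hence `√A` and `K₂` are `O(u ln n)`. On the exceptional event a constant bound on bias
and variance suffices. -/

/-! ### Continuity of the optimal weights in the similarity. -/

theorem objective_congr {s : Finset (ℤ × ℤ)} (σ : ℝ) {ρ ρ' : ℤ × ℤ → ℝ}
    (h : ∀ x ∈ s, ρ x = ρ' x) : objective s σ ρ = objective s σ ρ' := by
  funext w
  unfold objective
  rw [Finset.sum_congr rfl fun (x : s) _ => by rw [h x x.2]]

theorem optimalWeight_congr {s : Finset (ℤ × ℤ)} (σ : ℝ) {ρ ρ' : ℤ × ℤ → ℝ}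
    (h : ∀ x ∈ s, ρ x = ρ' x) : optimalWeight s σ ρ = optimalWeight s σ ρ' := by
  unfold optimalWeight IsOptimalWeight
  rw [objective_congr σ h]

theorem continuous_of_isClosed_graph_of_compactSpace {X K : Type*} [TopologicalSpace X]
    [TopologicalSpace K] [CompactSpace K] {g : X → K}
    (hg : IsClosed {p : X × K | p.2 = g p.1}) : Continuous g := by
  refine continuous_iff_isClosed.mpr fun F hF => ?_
  have h1 : IsClosed ({p : X × K | p.2 = g p.1} ∩ Prod.snd ⁻¹' F) :=
    hg.inter (hF.preimage continuous_snd)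
  have h2 := isClosedMap_fst_of_compactSpace _ h1
  convert h2 using 1
  ext x
  constructor
  · intro hx
    exact ⟨(x, g x), ⟨rfl, hx⟩, rfl⟩
  · rintro ⟨⟨a, b⟩, ⟨h3, h4⟩, rfl⟩
    simp only [Set.mem_ofPred_eq] at h3
    subst h3
    exact h4

theorem continuous_objective (s : Finset (ℤ × ℤ)) (σ : ℝ) :
    Continuous fun q : (ℤ × ℤ → ℝ) × (s → ℝ) => objective s σ q.1 q.2 := by
  unfold objective
  fun_prop

/-- By uniqueness of the minimizer, the graph is cut out by the closed conditions "no worse than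
`v`", and the simplex is compact, so a closed graph gives continuity. This supplies the
measurability of the random weights. -/
theorem continuous_optimalWeight (s : Finset (ℤ × ℤ)) (hs : s.Nonempty) {σ : ℝ} (hσ : 0 < σ) :
    Continuous (optimalWeight s σ) := by
  have : CompactSpace (stdSimplex ℝ s) := isCompact_iff_compactSpace.mp (isCompact_stdSimplex ℝ s)
  let g : (ℤ × ℤ → ℝ) → stdSimplex ℝ s := fun ρ =>
    ⟨optimalWeight s σ ρ, (optimalWeight_spec s hs σ hσ ρ).1⟩
  suffices hg : Continuous g from continuous_subtype_val.comp hg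
  apply continuous_of_isClosed_graph_of_compactSpace
  have : {p : (ℤ × ℤ → ℝ) × stdSimplex ℝ s | p.2 = g p.1} =
      ⋂ v ∈ stdSimplex ℝ s, {p | objective s σ p.1 p.2 ≤ objective s σ p.1 v} := by
    ext ⟨ρ, w, hw⟩
    simp only [Set.mem_ofPred_eq, Set.mem_iInter]
    constructor
    · intro h v hv
      obtain rfl : w = optimalWeight s σ ρ := congrArg Subtype.val h
      exact (optimalWeight_spec s hs σ hσ ρ).2 v hv
    · intro h
      exact Subtype.ext ((existsUnique_optimalWeight s hs σ hσ ρ).unique ⟨hw, h⟩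
        (optimalWeight_spec s hs σ hσ ρ))
  rw [this]
  have hc := continuous_objective s σ
  exact isClosed_biInter fun v _ => isClosed_le
    (hc.comp (continuous_fst.prodMk (continuous_subtype_val.comp continuous_snd)))
    (hc.comp (continuous_fst.prodMk continuous_const))

/-! ### Laplace transform of the square of a shifted Gaussian. -/

/-- Completing the square: the exponential tilt is a multiple of another Gaussian density, whose
total mass is one, so the integral can be read off from the prefactor. -/
theorem exp_sq_mul_gaussianPDFReal {v : ℝ≥0} (hv : v ≠ 0) {θ : ℝ} (hθ : 2 * θ * v < 1) (Δ z : ℝ) :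
    Real.exp (θ * (Δ + z) ^ 2) * gaussianPDFReal 0 v z =
      (√(1 - 2 * θ * v))⁻¹ * Real.exp (θ * Δ ^ 2 / (1 - 2 * θ * v)) *
        gaussianPDFReal (2 * θ * v * Δ / (1 - 2 * θ * v))
          (v / (1 - 2 * θ * v).toNNReal) z := by
  have hc : 0 < 1 - 2 * θ * v := by linarith
  have hv' : (0 : ℝ) < v := by positivity
  unfold gaussianPDFReal
  rw [NNReal.coe_div, Real.coe_toNNReal _ hc.le]
  set c := 1 - 2 * θ * v with hcdef
  have h1 : √(2 * Real.pi * (v / c)) = √(2 * Real.pi * v) / √c := by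
    rw [← Real.sqrt_div (by positivity)]
    congr 1
    ring
  have hsc : 0 < √c := Real.sqrt_pos.mpr hc
  rw [h1]
  have h2 : √c⁻¹ = (√c)⁻¹ := Real.sqrt_inv c
  have e : Real.exp (θ * (Δ + z) ^ 2) * Real.exp (-(z - 0) ^ 2 / (2 * v)) =
      Real.exp (θ * Δ ^ 2 / c) * Real.exp (-(z - 2 * θ * v * Δ / c) ^ 2 / (2 * (v / c))) := by
    rw [← Real.exp_add, ← Real.exp_add]
    congr 1
    have hθ' : θ = (1 - c) / (2 * v) := by rw [hcdef]; field_simp; ring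
    rw [hθ']
    field_simp
    ring
  calc _ = (√(2 * Real.pi * v))⁻¹ *
        (Real.exp (θ * (Δ + z) ^ 2) * Real.exp (-(z - 0) ^ 2 / (2 * v))) := by ring
    _ = _ := by
      rw [e]
      field_simp

/-- The Laplace transform of a noncentral chi-square distribution. -/
theorem lintegral_exp_sq_gaussianReal {v : ℝ≥0} (hv : v ≠ 0) {θ : ℝ} (hθ : 2 * θ * v < 1)
    (Δ : ℝ) :
    ∫⁻ z, ENNReal.ofReal (Real.exp (θ * (Δ + z) ^ 2)) ∂(gaussianReal 0 v) =
      ENNReal.ofReal ((√(1 - 2 * θ * v))⁻¹ * Real.exp (θ * Δ ^ 2 / (1 - 2 * θ * v))) := by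
  have hc : 0 < 1 - 2 * θ * v := by linarith
  rw [gaussianReal_of_var_ne_zero _ hv, lintegral_withDensity_eq_lintegral_mul _
    (measurable_gaussianPDF 0 v) (by fun_prop)]
  have : ∀ z, (gaussianPDF 0 v * fun z => ENNReal.ofReal (Real.exp (θ * (Δ + z) ^ 2))) z =
      ENNReal.ofReal ((√(1 - 2 * θ * v))⁻¹ * Real.exp (θ * Δ ^ 2 / (1 - 2 * θ * v))) *
        gaussianPDF (2 * θ * v * Δ / (1 - 2 * θ * v)) (v / (1 - 2 * θ * v).toNNReal) z := by
    intro z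
    rw [Pi.mul_apply, gaussianPDF, gaussianPDF, ← ENNReal.ofReal_mul (gaussianPDFReal_nonneg _ _ _),
      ← ENNReal.ofReal_mul (by positivity), mul_comm, exp_sq_mul_gaussianPDFReal hv hθ]
  simp_rw [this]
  rw [lintegral_const_mul _ (measurable_gaussianPDF _ _), lintegral_gaussianPDF_eq_one, mul_one]
  have : 0 < (1 - 2 * θ * v).toNNReal := Real.toNNReal_pos.mpr hc
  positivity

/-- Reduces to `exp (-(u + u²)) ≤ 1 - u`. Both signs of `u` matter, since the upper and lower tails
use opposite signs of the Laplace parameter. -/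
theorem inv_sqrt_one_sub_le {u : ℝ} (hu : |u| ≤ 1 / 2) :
    (√(1 - u))⁻¹ ≤ Real.exp ((u + u ^ 2) / 2) := by
  obtain ⟨h1, h2⟩ := abs_le.mp hu
  have hpos : 0 < 1 - u := by linarith
  have key : Real.exp (-(u + u ^ 2)) ≤ 1 - u := by
    rw [Real.exp_neg]
    rcases le_or_gt 0 u with h | h
    · rw [inv_le_comm₀ (Real.exp_pos _) hpos]
      have h5 : 1 + (u + u ^ 2) + (u + u ^ 2) ^ 2 / 2 ≤ Real.exp (u + u ^ 2) :=
        Real.quadratic_le_exp_of_nonneg (by positivity)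
      refine le_trans ?_ h5
      rw [inv_le_iff_one_le_mul₀ hpos]
      nlinarith [sq_nonneg u, pow_nonneg h 3, pow_nonneg h 4,
        mul_nonneg (sq_nonneg u) (by linarith : 0 ≤ 1 / 2 - u)]
    · rw [← Real.exp_neg]
      have h6 : 0 ≤ -(u + u ^ 2) := by nlinarith
      have h7 : -(u + u ^ 2) ≤ 1 / 4 := by nlinarith [sq_nonneg (u + 1 / 2)]
      have := Real.exp_bound' h6 (by linarith) (n := 2) (by norm_num)
      simp [Finset.sum_range_succ] at this
      have h8 : (-u ^ 2 + -u) ^ 2 ≤ (-u) ^ 2 :=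
        pow_le_pow_left₀ (by nlinarith) (by nlinarith [sq_nonneg u]) 2
      rw [show -(u + u ^ 2) = -u ^ 2 + -u by ring]
      nlinarith
  rw [inv_le_comm₀ (Real.sqrt_pos.mpr hpos) (Real.exp_pos _), ← Real.exp_neg]
  apply Real.le_sqrt_of_sq_le
  rw [← Real.exp_nat_mul]
  refine le_trans (le_of_eq ?_) key
  congr 1
  push_cast
  ring

theorem lintegral_exp_sq_gaussianReal_le {v : ℝ≥0} (hv : v ≠ 0) {θ : ℝ} (hθ : |2 * θ * v| ≤ 1 / 2)
    (Δ : ℝ) :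
    ∫⁻ z, ENNReal.ofReal (Real.exp (θ * (Δ + z) ^ 2)) ∂(gaussianReal 0 v) ≤
      ENNReal.ofReal (Real.exp (θ * v + 2 * θ ^ 2 * v ^ 2 + θ * Δ ^ 2 / (1 - 2 * θ * v))) := by
  obtain ⟨h1, h2⟩ := abs_le.mp hθ
  rw [lintegral_exp_sq_gaussianReal hv (by linarith), Real.exp_add]
  refine ENNReal.ofReal_le_ofReal (mul_le_mul_of_nonneg_right ?_ (Real.exp_pos _).le)
  refine (inv_sqrt_one_sub_le hθ).trans (le_of_eq ?_)
  congr 1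
  ring

/-! ### Chernoff bounds for sums of squared noise differences. -/

section Concentration

variable {Ω ι κ : Type*} [MeasurableSpace Ω] {μ : Measure Ω} {ε : ι → Ω → ℝ} {v : ℝ≥0}

/-- The index pairs `{a y, b y}` are pairwise disjoint on `A`, so the differences involve separate
blocks of independent variables; one block is split off at each induction step. -/
theorem lintegral_prod_sub_eq [DecidableEq ι] [DecidableEq κ] (hind : iIndepFun ε μ)
    (hmeas : ∀ i, Measurable (ε i))
    (A : Finset κ) (a b : κ → ι) (G : κ → ℝ → ℝ≥0∞) (hG : ∀ y, Measurable (G y))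
    (hA : ∀ y ∈ A, ∀ y' ∈ A, y ≠ y' → a y ≠ a y' ∧ b y ≠ b y' ∧ a y ≠ b y') :
    ∫⁻ ω, ∏ y ∈ A, G y (ε (a y) ω - ε (b y) ω) ∂μ =
      ∏ y ∈ A, ∫⁻ ω, G y (ε (a y) ω - ε (b y) ω) ∂μ := by
  have : IsProbabilityMeasure μ := hind.isProbabilityMeasure
  induction A using Finset.cons_induction with
  | empty => simp
  | cons j A hj ih =>
    simp only [Finset.prod_cons]
    rw [← ih fun y hy y' hy' => hA y (Finset.mem_cons_of_mem hy) y' (Finset.mem_cons_of_mem hy')]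
    have hdisj : Disjoint ({a j, b j} : Finset ι) (A.image a ∪ A.image b) := by
      rw [Finset.disjoint_left]
      intro i hi hi'
      have hne : ∀ y ∈ A, y ≠ j := fun y hy h => hj (h ▸ hy)
      simp only [Finset.mem_insert, Finset.mem_singleton, Finset.mem_union,
        Finset.mem_image] at hi hi'
      obtain ⟨y, hy, rfl⟩ | ⟨y, hy, rfl⟩ := hi'
      · have h1 := hA y (Finset.mem_cons_of_mem hy) j (Finset.mem_cons_self j A) (hne y hy)
        tauto
      · have h1 := hA y (Finset.mem_cons_of_mem hy) j (Finset.mem_cons_self j A) (hne y hy)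
        have h2 := hA j (Finset.mem_cons_self j A) y (Finset.mem_cons_of_mem hy) (hne y hy).symm
        rcases hi with hi | hi
        · exact h2.2.2 hi.symm
        · exact h1.2.1 hi
    have hST := hind.indepFun_finset _ _ hdisj hmeas
    let φ : (({a j, b j} : Finset ι) → ℝ) → ℝ≥0∞ := fun e =>
      G j (e ⟨a j, by simp⟩ - e ⟨b j, by simp⟩)
    let ψ : ((A.image a ∪ A.image b : Finset ι) → ℝ) → ℝ≥0∞ := fun e =>
      ∏ y ∈ A.attach, G y (e ⟨a y, Finset.mem_union_left _ (Finset.mem_image_of_mem a y.2)⟩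
        - e ⟨b y, Finset.mem_union_right _ (Finset.mem_image_of_mem b y.2)⟩)
    have hφ : Measurable φ := (hG j).comp (by fun_prop)
    have hψ : Measurable ψ := Finset.measurable_prod _ fun y _ => (hG y).comp (by fun_prop)
    have hcomp := hST.comp hφ hψ
    have := lintegral_mul_eq_lintegral_mul_lintegral_of_indepFun
      (hφ.comp (by fun_prop)) (hψ.comp (by fun_prop)) hcomp
    have e2 : ∀ ω, (ψ ∘ fun ω (i : (A.image a ∪ A.image b : Finset ι)) => ε i ω) ω =
        ∏ y ∈ A, G y (ε (a y) ω - ε (b y) ω) := fun ω =>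
      Finset.prod_attach A fun y => G y (ε (a y) ω - ε (b y) ω)
    simp only [Pi.mul_apply, e2] at this
    exact this

theorem map_sub_eq_gaussianReal (hind : iIndepFun ε μ) (hmeas : ∀ i, Measurable (ε i))
    (hlaw : ∀ i, μ.map (ε i) = gaussianReal 0 v) {i j : ι} (hij : i ≠ j) :
    μ.map (fun ω => ε i ω - ε j ω) = gaussianReal 0 (v + v) := by
  have h1 : IndepFun (ε i) (-ε j) μ :=
    (hind.indepFun hij).comp (φ := id) (ψ := fun x => -x) measurable_id measurable_neg
  have h2 : μ.map (-ε j) = gaussianReal 0 v := by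
    have := (ProbabilityTheory.gaussianReal_neg (X := ε j) (P := μ) ⟨(hmeas j).aemeasurable, hlaw j⟩)
    simpa using this.map_eq
  have := gaussianReal_add_gaussianReal_of_indepFun h1 (hlaw i) h2
  rw [add_zero] at this
  rw [← this]
  congr 1

/-- A noise variable can occur in two differences, as `a y` and as `b y'`, but `χ` gives these
different colours. Within a colour the differences are independent, and Cauchy–Schwarz recombines
the two colours at the price of doubling `θ`. -/
theorem lintegral_exp_sum_sq_le [DecidableEq ι] [DecidableEq κ] (hind : iIndepFun ε μ)
    (hmeas : ∀ i, Measurable (ε i)) (hlaw : ∀ i, μ.map (ε i) = gaussianReal 0 v) (hv : v ≠ 0)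
    (V : Finset κ) (a b : κ → ι) (ha : Set.InjOn a V) (hb : Set.InjOn b V)
    (hab : ∀ y ∈ V, a y ≠ b y) (χ : κ → Prop) [DecidablePred χ]
    (hχ : ∀ y ∈ V, ∀ y' ∈ V, a y = b y' → ¬(χ y ↔ χ y'))
    (Δ : κ → ℝ) {θ w : ℝ} (hw : w = 2 * v) (hθ : |4 * θ * w| ≤ 1 / 2) :
    ∫⁻ ω, ENNReal.ofReal
        (Real.exp (θ * ∑ y ∈ V, (Δ y + (ε (a y) ω - ε (b y) ω)) ^ 2)) ∂μ ≤
      ENNReal.ofReal (Real.exp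
        (∑ y ∈ V, (θ * w + 4 * θ ^ 2 * w ^ 2 + θ * Δ y ^ 2 / (1 - 4 * θ * w)))) := by
  have hvv : ((v + v : ℝ≥0) : ℝ) = w := by push_cast; rw [hw]; ring
  -- The squares are the second moments that Cauchy–Schwarz will require.
  have hclass : ∀ A ⊆ V, (∀ y ∈ A, ∀ y' ∈ A, (χ y ↔ χ y')) →
      ∫⁻ ω, (ENNReal.ofReal
        (Real.exp (θ * ∑ y ∈ A, (Δ y + (ε (a y) ω - ε (b y) ω)) ^ 2))) ^ (2 : ℝ) ∂μ ≤
      (ENNReal.ofReal (Real.exp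
        (∑ y ∈ A, (θ * w + 4 * θ ^ 2 * w ^ 2 + θ * Δ y ^ 2 / (1 - 4 * θ * w))))) ^ (2 : ℝ) := by
    intro A hAV hA
    have e1 : ∀ ω, (ENNReal.ofReal
        (Real.exp (θ * ∑ y ∈ A, (Δ y + (ε (a y) ω - ε (b y) ω)) ^ 2))) ^ (2 : ℝ) =
        ∏ y ∈ A, ENNReal.ofReal (Real.exp (2 * θ * (Δ y + (ε (a y) ω - ε (b y) ω)) ^ 2)) := by
      intro ω
      rw [ENNReal.ofReal_rpow_of_pos (Real.exp_pos _), ← Real.exp_mul,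
        ← ENNReal.ofReal_prod_of_nonneg fun _ _ => (Real.exp_pos _).le, ← Real.exp_sum,
        ← Finset.mul_sum]
      congr 2
      ring
    have e2 : (ENNReal.ofReal (Real.exp
        (∑ y ∈ A, (θ * w + 4 * θ ^ 2 * w ^ 2 + θ * Δ y ^ 2 / (1 - 4 * θ * w))))) ^ (2 : ℝ) =
        ∏ y ∈ A, ENNReal.ofReal (Real.exp
          (2 * θ * w + 2 * (2 * θ) ^ 2 * w ^ 2 + 2 * θ * Δ y ^ 2 / (1 - 2 * (2 * θ) * w))) := by
      rw [ENNReal.ofReal_rpow_of_pos (Real.exp_pos _), ← Real.exp_mul,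
        ← ENNReal.ofReal_prod_of_nonneg fun _ _ => (Real.exp_pos _).le, ← Real.exp_sum,
        Finset.sum_mul]
      congr 2
      refine Finset.sum_congr rfl fun y _ => ?_
      ring
    simp_rw [e1]
    rw [e2, lintegral_prod_sub_eq hind hmeas A a b
      (fun y x => ENNReal.ofReal (Real.exp (2 * θ * (Δ y + x) ^ 2))) (fun y => by fun_prop)]
    · refine Finset.prod_le_prod' fun y hy => ?_
      rw [← lintegral_map (μ := μ) (g := fun ω => ε (a y) ω - ε (b y) ω)
        (f := fun x => ENNReal.ofReal (Real.exp (2 * θ * (Δ y + x) ^ 2))) (by fun_prop)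
        (by fun_prop), map_sub_eq_gaussianReal hind hmeas hlaw (hab y (hAV hy))]
      have := lintegral_exp_sq_gaussianReal_le (v := v + v) (by positivity) (θ := 2 * θ)
        (by rw [hvv]; convert hθ using 2; ring) (Δ y)
      rwa [hvv] at this
    · intro y hy y' hy' hne
      refine ⟨fun h => hne (ha (hAV hy) (hAV hy') h), fun h => hne (hb (hAV hy) (hAV hy') h),
        fun h => hχ y (hAV hy) y' (hAV hy') h (hA y hy y' hy')⟩
  have h0 := hclass (V.filter χ) (Finset.filter_subset _ _) (by
    intro y hy y' hy'; simp only [Finset.mem_filter] at hy hy'; tauto)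
  have h1 := hclass (V.filter (¬χ ·)) (Finset.filter_subset _ _) (by
    intro y hy y' hy'; simp only [Finset.mem_filter] at hy hy'; tauto)
  have hcs := ENNReal.lintegral_mul_le_Lp_mul_Lq μ Real.HolderConjugate.two_two
    (f := fun ω => ENNReal.ofReal
        (Real.exp (θ * ∑ y ∈ V.filter χ, (Δ y + (ε (a y) ω - ε (b y) ω)) ^ 2)))
    (g := fun ω => ENNReal.ofReal
        (Real.exp (θ * ∑ y ∈ V.filter (¬χ ·), (Δ y + (ε (a y) ω - ε (b y) ω)) ^ 2)))
    (by fun_prop) (by fun_prop)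
  have hsplit : ∀ F : κ → ℝ, ENNReal.ofReal (Real.exp (∑ y ∈ V, F y)) =
      ENNReal.ofReal (Real.exp (∑ y ∈ V.filter χ, F y)) *
        ENNReal.ofReal (Real.exp (∑ y ∈ V.filter (¬χ ·), F y)) := by
    intro F
    rw [← ENNReal.ofReal_mul (Real.exp_pos _).le, ← Real.exp_add,
      Finset.sum_filter_add_sum_filter_not]
  have hsqrt : ∀ {x y : ℝ≥0∞}, x ≤ y ^ (2 : ℝ) → x ^ (1 / 2 : ℝ) ≤ y := by
    intro x y h
    calc x ^ (1 / 2 : ℝ) ≤ (y ^ (2 : ℝ)) ^ (1 / 2 : ℝ) := ENNReal.rpow_le_rpow h (by norm_num)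
      _ = y := by rw [← ENNReal.rpow_mul]; norm_num
  calc _ = ∫⁻ ω, ENNReal.ofReal
          (Real.exp (θ * ∑ y ∈ V.filter χ, (Δ y + (ε (a y) ω - ε (b y) ω)) ^ 2)) *
        ENNReal.ofReal (Real.exp
          (θ * ∑ y ∈ V.filter (¬χ ·), (Δ y + (ε (a y) ω - ε (b y) ω)) ^ 2)) ∂μ := by
        refine lintegral_congr fun ω => ?_
        simp_rw [Finset.mul_sum]
        rw [hsplit]
    _ ≤ _ := hcs
    _ ≤ _ := by
      rw [hsplit]
      exact mul_le_mul' (hsqrt h0) (hsqrt h1)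

theorem measure_le_of_lintegral_exp_le {Z : Ω → ℝ} (hZ : Measurable Z) {c r : ℝ}
    (h : ∫⁻ ω, ENNReal.ofReal (Real.exp (Z ω)) ∂μ ≤ ENNReal.ofReal (Real.exp c)) :
    μ {ω | r ≤ Z ω} ≤ ENNReal.ofReal (Real.exp (c - r)) := by
  have h1 := mul_meas_ge_le_lintegral (μ := μ)
    (f := fun ω => ENNReal.ofReal (Real.exp (Z ω))) (by fun_prop) (ENNReal.ofReal (Real.exp r))
  have h2 : {ω | r ≤ Z ω} = {ω | ENNReal.ofReal (Real.exp r) ≤ ENNReal.ofReal (Real.exp (Z ω))} := by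
    ext ω
    simp [ENNReal.ofReal_le_ofReal_iff (Real.exp_pos _).le]
  rw [h2, Real.exp_sub, ENNReal.ofReal_div_of_pos (Real.exp_pos _),
    ENNReal.le_div_iff_mul_le (by simp [Real.exp_pos]) (by simp), mul_comm]
  exact h1.trans h

/-- Concentration of the sum of squares of Gaussian differences `ε (a y) - ε (b y)` with shifts
`Δ y`, from above. -/
theorem measure_sum_sq_ge_le [DecidableEq ι] [DecidableEq κ] (hind : iIndepFun ε μ)
    (hmeas : ∀ i, Measurable (ε i)) (hlaw : ∀ i, μ.map (ε i) = gaussianReal 0 v) (hv : v ≠ 0)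
    (V : Finset κ) (a b : κ → ι) (ha : Set.InjOn a V) (hb : Set.InjOn b V)
    (hab : ∀ y ∈ V, a y ≠ b y) (χ : κ → Prop) [DecidablePred χ]
    (hχ : ∀ y ∈ V, ∀ y' ∈ V, a y = b y' → ¬(χ y ↔ χ y'))
    (Δ : κ → ℝ) {θ w : ℝ} (hw : w = 2 * v) (hθ0 : 0 < θ) (hθ : 4 * θ * w ≤ 1 / 2) :
    μ {ω | V.card * (w + (4 * w ^ 2 + 1) * θ) + 2 * ∑ y ∈ V, Δ y ^ 2 ≤
        ∑ y ∈ V, (Δ y + (ε (a y) ω - ε (b y) ω)) ^ 2} ≤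
      ENNReal.ofReal (Real.exp (-(θ ^ 2 * V.card))) := by
  have hw0 : 0 < w := by rw [hw]; positivity
  have h1 := lintegral_exp_sum_sq_le hind hmeas hlaw hv V a b ha hb hab χ hχ Δ hw
    (θ := θ) (by rw [abs_of_pos (by positivity)]; exact hθ)
  have h2 := measure_le_of_lintegral_exp_le (μ := μ) (by fun_prop) h1
    (r := θ * (V.card * (w + (4 * w ^ 2 + 1) * θ) + 2 * ∑ y ∈ V, Δ y ^ 2))
  simp only [mul_le_mul_iff_right₀ hθ0] at h2
  refine h2.trans (ENNReal.ofReal_le_ofReal (Real.exp_le_exp.mpr ?_))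
  -- Since `4 θ w ≤ 1 / 2`, the shift is inflated by at most `2`. In `4 w² + 1` the first term
  -- absorbs the quadratic Laplace term, and the `1` leaves the exponent `-θ² card`.
  have h3 : ∑ y ∈ V, (θ * w + 4 * θ ^ 2 * w ^ 2 + θ * Δ y ^ 2 / (1 - 4 * θ * w)) ≤
      ∑ y ∈ V, (θ * w + 4 * θ ^ 2 * w ^ 2 + 2 * θ * Δ y ^ 2) := by
    refine Finset.sum_le_sum fun y _ => ?_
    have : θ * Δ y ^ 2 / (1 - 4 * θ * w) ≤ 2 * θ * Δ y ^ 2 := by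
      rw [div_le_iff₀ (by linarith)]
      nlinarith [mul_nonneg hθ0.le (sq_nonneg (Δ y))]
    linarith
  have h4 : ∑ y ∈ V, (θ * w + 4 * θ ^ 2 * w ^ 2 + 2 * θ * Δ y ^ 2) =
      V.card * (θ * w + 4 * θ ^ 2 * w ^ 2) + 2 * θ * ∑ y ∈ V, Δ y ^ 2 := by
    rw [Finset.sum_add_distrib, Finset.sum_const, nsmul_eq_mul, ← Finset.mul_sum]
  linarith

/-- Concentration of the sum of squares of Gaussian differences `ε (a y) - ε (b y)` with shifts
`Δ y`, from below. -/
theorem measure_sum_sq_le_le [DecidableEq ι] [DecidableEq κ] (hind : iIndepFun ε μ)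
    (hmeas : ∀ i, Measurable (ε i)) (hlaw : ∀ i, μ.map (ε i) = gaussianReal 0 v) (hv : v ≠ 0)
    (V : Finset κ) (a b : κ → ι) (ha : Set.InjOn a V) (hb : Set.InjOn b V)
    (hab : ∀ y ∈ V, a y ≠ b y) (χ : κ → Prop) [DecidablePred χ]
    (hχ : ∀ y ∈ V, ∀ y' ∈ V, a y = b y' → ¬(χ y ↔ χ y'))
    (Δ : κ → ℝ) {θ w : ℝ} (hw : w = 2 * v) (hθ0 : 0 < θ) (hθ : 4 * θ * w ≤ 1 / 2) :
    μ {ω | ∑ y ∈ V, (Δ y + (ε (a y) ω - ε (b y) ω)) ^ 2 ≤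
        V.card * (w - (4 * w ^ 2 + 1) * θ) + (∑ y ∈ V, Δ y ^ 2) / 2} ≤
      ENNReal.ofReal (Real.exp (-(θ ^ 2 * V.card))) := by
  have hw0 : 0 < w := by rw [hw]; positivity
  have h1 := lintegral_exp_sum_sq_le hind hmeas hlaw hv V a b ha hb hab χ hχ Δ hw
    (θ := -θ) (by
      rw [show 4 * -θ * w = -(4 * θ * w) by ring, abs_neg, abs_of_pos (by positivity)]; exact hθ)
  have h2 := measure_le_of_lintegral_exp_le (μ := μ) (by fun_prop) h1
    (r := -θ * (V.card * (w - (4 * w ^ 2 + 1) * θ) + (∑ y ∈ V, Δ y ^ 2) / 2))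
  simp only [neg_mul, neg_le_neg_iff, mul_le_mul_iff_right₀ hθ0] at h2
  refine h2.trans (ENNReal.ofReal_le_ofReal (Real.exp_le_exp.mpr ?_))
  have h3 : ∑ y ∈ V, (-(θ * w) + 4 * (-θ) ^ 2 * w ^ 2 + -(θ * Δ y ^ 2) / (1 - 4 * -θ * w)) ≤
      ∑ y ∈ V, (-(θ * w) + 4 * θ ^ 2 * w ^ 2 + -(θ / 2) * Δ y ^ 2) := by
    refine Finset.sum_le_sum fun y _ => ?_
    have h5 : 0 < 4 * θ * w := by positivity
    have : -(θ * Δ y ^ 2) / (1 - 4 * -θ * w) ≤ -(θ / 2) * Δ y ^ 2 := by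
      rw [div_le_iff₀ (by linarith)]
      nlinarith [mul_nonneg hθ0.le (sq_nonneg (Δ y))]
    rw [neg_sq]
    linarith
  have h4 : ∑ y ∈ V, (-(θ * w) + 4 * θ ^ 2 * w ^ 2 + -(θ / 2) * Δ y ^ 2) =
      V.card * (-(θ * w) + 4 * θ ^ 2 * w ^ 2) + -(θ / 2) * ∑ y ∈ V, Δ y ^ 2 := by
    rw [Finset.sum_add_distrib, Finset.sum_const, nsmul_eq_mul, ← Finset.mul_sum]
  linarith

end Concentration

/-! ### Windows, parity and pixel counts. -/

section Geometry

variable {N : ℕ} {x₀ x y : ℤ × ℤ} {h η r : ℝ}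

theorem norm_pos_sub_pos_le_iff (hN : 0 < N) :
    ‖pos N y - pos N x‖ ≤ r ↔
      |((y.1 - x.1 : ℤ) : ℝ)| ≤ r * N ∧ |((y.2 - x.2 : ℤ) : ℝ)| ≤ r * N := by
  have hN' : (0 : ℝ) < N := by exact_mod_cast hN
  simp only [pos, Prod.mk_sub_mk, Prod.norm_def, Real.norm_eq_abs, max_le_iff, ← sub_div, abs_div,
    Nat.abs_cast, div_le_iff₀ hN', Int.cast_sub]

theorem pos_translate_sub (N : ℕ) (x₀ x y : ℤ × ℤ) :
    pos N (x + (y - x₀)) - pos N x = pos N y - pos N x₀ := by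
  simp only [pos, Prod.fst_add, Prod.snd_add, Prod.fst_sub, Prod.snd_sub, Int.cast_add,
    Int.cast_sub, Prod.mk_sub_mk]
  ext <;> ring

theorem pos_translate_sub' (N : ℕ) (x₀ x y : ℤ × ℤ) :
    pos N (x + (y - x₀)) - pos N y = pos N x - pos N x₀ := by
  simp only [pos, Prod.fst_add, Prod.snd_add, Prod.fst_sub, Prod.snd_sub, Int.cast_add,
    Int.cast_sub, Prod.mk_sub_mk]
  ext <;> ring

theorem mem_window : y ∈ window N x r ↔ y ∈ grid N ∧ ‖pos N y - pos N x‖ ≤ r := by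
  simp [window]

theorem mem_window_self (hx₀ : x₀ ∈ grid N) (hr : 0 ≤ r) : x₀ ∈ window N x₀ r := by
  simp [mem_window, hx₀, hr]

theorem mem_searchEven :
    y ∈ searchEven N x₀ r ↔ y ∈ window N x₀ r ∧ Even ((y.1 - x₀.1) + (y.2 - x₀.2)) := by
  simp only [searchEven, evenPixels, Finset.mem_inter, Finset.mem_filter, mem_window]
  tauto

theorem mem_patchOdd :
    y ∈ patchOdd N x₀ x r ↔ y ∈ window N x r ∧ ¬ Even ((y.1 - x₀.1) + (y.2 - x₀.2)) := by
  simp only [patchOdd, oddPixels, evenPixels, Finset.mem_inter, Finset.mem_filter, mem_window,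
    Finset.mem_sdiff]
  tauto

theorem translate_mem_grid {z : ℤ × ℤ} (hPI : PatchesInside N x₀ h η) (hx : x ∈ window N x₀ h)
    (hy : ‖pos N y - pos N z‖ ≤ η) : x + (y - z) ∈ grid N := by
  refine hPI x hx _ ?_
  convert hy using 2
  simp only [pos, Prod.fst_sub, Prod.snd_sub, Int.cast_sub, Prod.mk_sub_mk]
  ext <;> ring

theorem translate_mem_patchOdd (hPI : PatchesInside N x₀ h η) (hx : x ∈ searchEven N x₀ h)
    (hy : y ∈ patchOdd N x₀ x₀ η) : x + (y - x₀) ∈ patchOdd N x₀ x η := by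
  rw [mem_searchEven] at hx
  rw [mem_patchOdd, mem_window] at hy ⊢
  refine ⟨⟨translate_mem_grid hPI hx.1 hy.1.2, ?_⟩, ?_⟩
  · rw [pos_translate_sub]; exact hy.1.2
  · have h1 := hx.2
    have h2 := hy.2
    simp only [Prod.fst_add, Prod.snd_add, Prod.fst_sub, Prod.snd_sub]
    grind

/-- Translation by the even displacement `x - x₀` is a bijection between the odd patches, since none
is cut off by the border. Thus the normalization of `patchDist` is the number of its summands. -/
theorem card_patchOdd (hPI : PatchesInside N x₀ h η) (hx₀ : x₀ ∈ grid N) (hh : 0 ≤ h)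
    (hx : x ∈ searchEven N x₀ h) :
    (patchOdd N x₀ x η).card = (patchOdd N x₀ x₀ η).card := by
  symm
  refine Finset.card_bij (fun y _ => x + (y - x₀)) (fun y hy => translate_mem_patchOdd hPI hx hy)
    (fun y _ y' _ h => by simpa using h) fun z hz => ⟨x₀ + (z - x), ?_, by abel⟩
  rw [mem_searchEven] at hx
  rw [mem_patchOdd, mem_window] at hz ⊢
  refine ⟨⟨translate_mem_grid hPI (mem_window_self hx₀ hh) hz.1.2, ?_⟩, ?_⟩
  · rw [pos_translate_sub]; exact hz.1.2
  · have h1 := hx.2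
    have h2 := hz.2
    simp only [Prod.fst_add, Prod.snd_add, Prod.fst_sub, Prod.snd_sub]
    grind

theorem div_four_le_floor_div_two {t : ℝ} (ht : 4 ≤ t) : t / 4 ≤ ((⌊t⌋₊ / 2 : ℕ) : ℝ) := by
  have h1 : ⌊t⌋₊ ≤ 2 * (⌊t⌋₊ / 2) + 1 := by omega
  have h2 : (⌊t⌋₊ : ℝ) ≤ 2 * ((⌊t⌋₊ / 2 : ℕ) : ℝ) + 1 := by exact_mod_cast h1
  have h3 := Nat.lt_floor_add_one t
  linarith

theorem card_image_lattice (k : ℕ) (x₀ : ℤ × ℤ) (o : ℤ) {s₁ s₂ : ℤ} (h₁ : |s₁| = 1)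
    (h₂ : |s₂| = 1) :
    ((Finset.range k ×ˢ Finset.range k).image fun p : ℕ × ℕ =>
      (x₀.1 + s₁ * (2 * p.1 + o), x₀.2 + s₂ * (2 * p.2))).card = k ^ 2 := by
  rw [Finset.card_image_of_injective]
  · simp [sq]
  · rintro ⟨a, b⟩ ⟨c, d⟩ h
    have h1 : s₁ ≠ 0 := by rintro rfl; simp at h₁
    have h2 : s₂ ≠ 0 := by rintro rfl; simp at h₂
    simpa [h1, h2] using h

/-- One quadrant, sampled with step two in each coordinate, is already enough; the points lie in the
image because `r ≤ η`. -/
theorem le_card_searchEven (hN : 0 < N) (hx₀ : x₀ ∈ grid N) (hPI : PatchesInside N x₀ h η)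
    (hh : 0 ≤ h) (hrη : r ≤ η) (hr : 4 ≤ r * N) :
    (r * N) ^ 2 / 16 ≤ (searchEven N x₀ r).card := by
  set k := ⌊r * N⌋₊ / 2
  have hk := div_four_le_floor_div_two hr
  have hk2 : 2 * (k : ℝ) ≤ r * N := by
    have h1 : 2 * k ≤ ⌊r * N⌋₊ := by omega
    exact le_trans (by exact_mod_cast h1) (Nat.floor_le (by linarith))
  have hc := card_image_lattice k x₀ 0 (s₁ := 1) (s₂ := 1) (by simp) (by simp)
  have hN' : (0 : ℝ) < N := by exact_mod_cast hN
  calc (r * N) ^ 2 / 16 = (r * N / 4) ^ 2 := by ring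
    _ ≤ (k : ℝ) ^ 2 := pow_le_pow_left₀ (by linarith) hk 2
    _ ≤ _ := by
      rw [← Nat.cast_pow, ← hc]
      refine Nat.cast_le.mpr (Finset.card_le_card fun y hy => ?_)
      simp only [Finset.mem_image, Finset.mem_product, Finset.mem_range] at hy
      obtain ⟨⟨a, b⟩, ⟨ha, hb⟩, rfl⟩ := hy
      have ha' : (a : ℝ) ≤ k := by exact_mod_cast ha.le
      have hb' : (b : ℝ) ≤ k := by exact_mod_cast hb.le
      have hnorm : ‖pos N (x₀.1 + 1 * (2 * (a : ℤ) + 0), x₀.2 + 1 * (2 * (b : ℤ))) - pos N x₀‖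
          ≤ r := by
        rw [norm_pos_sub_pos_le_iff hN]
        push_cast
        constructor <;>
        · rw [abs_of_nonneg (by ring_nf; positivity)]
          linarith
      rw [mem_searchEven, mem_window]
      refine ⟨⟨?_, hnorm⟩, ?_⟩
      · have := translate_mem_grid hPI (mem_window_self hx₀ hh) (hnorm.trans hrη)
        simpa using this
      · simp only []
        grind

/-- Around every centre `x` of the search window there are many odd displacements `y - x₀` of
length at most `r` which keep both `y` and `x + (y - x₀)` in the search window. -/
theorem exists_subset_patchOdd (hN : 0 < N) (hx₀ : x₀ ∈ grid N) (hPI : PatchesInside N x₀ h η)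
    (hh : 0 ≤ h) (hrh : r ≤ h) (hrη : r ≤ η) (hr : 4 ≤ r * N) (hx : x ∈ window N x₀ h) :
    ∃ Q ⊆ patchOdd N x₀ x₀ η, (r * N) ^ 2 / 16 ≤ (Q.card : ℝ) ∧ ∀ y ∈ Q,
      ‖pos N y - pos N x₀‖ ≤ r ∧ y ∈ window N x₀ h ∧ x + (y - x₀) ∈ window N x₀ h := by
  set k := ⌊r * N⌋₊ / 2
  have hk := div_four_le_floor_div_two hr
  have hk2 : 2 * (k : ℝ) ≤ r * N := by
    have h1 : 2 * k ≤ ⌊r * N⌋₊ := by omega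
    exact le_trans (by exact_mod_cast h1) (Nat.floor_le (by linarith))
  have hN' : (0 : ℝ) < N := by exact_mod_cast hN
  -- In each coordinate the displacement points from `x` back towards `x₀`, so that `x + (y - x₀)`
  -- cannot leave the search window; overshooting `x₀` is harmless because `r ≤ h`.
  have hsign : ∀ t : ℤ, |(t : ℝ)| ≤ h * N → ∃ s : ℤ, |s| = 1 ∧ ∀ a : ℝ, 0 ≤ a → a ≤ r * N →
      |(t : ℝ) + s * a| ≤ h * N := by
    intro t ht
    have hrN : r * N ≤ h * N := by gcongr
    obtain ⟨h1, h2⟩ := abs_le.mp ht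
    rcases le_total 0 t with h0 | h0
    · have h0' : (0 : ℝ) ≤ t := by exact_mod_cast h0
      refine ⟨-1, by simp, fun a ha ha' => abs_le.mpr ?_⟩
      push_cast
      constructor <;> linarith
    · have h0' : (t : ℝ) ≤ 0 := by exact_mod_cast h0
      refine ⟨1, by simp, fun a ha ha' => abs_le.mpr ?_⟩
      push_cast
      constructor <;> linarith
  have hxn := (norm_pos_sub_pos_le_iff hN).mp (mem_window.mp hx).2
  obtain ⟨s₁, hs₁, hs₁'⟩ := hsign _ hxn.1
  obtain ⟨s₂, hs₂, hs₂'⟩ := hsign _ hxn.2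
  have hc := card_image_lattice k x₀ 1 hs₁ hs₂
  have hs₁r : |(s₁ : ℝ)| = 1 := by exact_mod_cast hs₁
  have hs₂r : |(s₂ : ℝ)| = 1 := by exact_mod_cast hs₂
  have key : ∀ y ∈ (Finset.range k ×ˢ Finset.range k).image fun p : ℕ × ℕ =>
      (x₀.1 + s₁ * (2 * (p.1 : ℤ) + 1), x₀.2 + s₂ * (2 * (p.2 : ℤ))),
      ‖pos N y - pos N x₀‖ ≤ r ∧ y ∈ grid N ∧ x + (y - x₀) ∈ window N x₀ h ∧
        ¬ Even ((y.1 - x₀.1) + (y.2 - x₀.2)) := by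
    intro y hy
    simp only [Finset.mem_image, Finset.mem_product, Finset.mem_range] at hy
    obtain ⟨⟨a, b⟩, ⟨ha, hb⟩, rfl⟩ := hy
    simp only at ha hb
    have ha' : (a : ℝ) + 1 ≤ k := by exact_mod_cast ha
    have hb' : (b : ℝ) + 1 ≤ k := by exact_mod_cast hb
    have hnorm : ‖pos N (x₀.1 + s₁ * (2 * (a : ℤ) + 1), x₀.2 + s₂ * (2 * (b : ℤ))) - pos N x₀‖
        ≤ r := by
      rw [norm_pos_sub_pos_le_iff hN]
      simp only [add_sub_cancel_left, Int.cast_mul, abs_mul, hs₁r, hs₂r, one_mul]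
      push_cast
      constructor
      · rw [abs_of_nonneg (by positivity)]; linarith
      · rw [abs_of_nonneg (by positivity), abs_of_nonneg (by positivity)]; linarith
    refine ⟨hnorm, ?_, ?_, ?_⟩
    · have := translate_mem_grid hPI (mem_window_self hx₀ hh) (hnorm.trans hrη)
      simpa using this
    · refine mem_window.mpr ⟨translate_mem_grid hPI hx (hnorm.trans hrη), ?_⟩
      rw [norm_pos_sub_pos_le_iff hN]
      have e1 := hs₁' (2 * a + 1) (by positivity) (by linarith)
      have e2 := hs₂' (2 * b) (by positivity) (by linarith)
      simp only [Prod.fst_add, Prod.snd_add, Prod.fst_sub, Prod.snd_sub, add_sub_cancel_left]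
      push_cast at e1 e2 ⊢
      constructor
      · convert e1 using 2; ring
      · convert e2 using 2; ring
    · have hs : ∀ s : ℤ, |s| = 1 → s = 1 ∨ s = -1 := fun s hs => (abs_eq (by norm_num)).mp hs
      simp only [add_sub_cancel_left]
      rcases hs _ hs₁ with rfl | rfl <;> grind
  refine ⟨(Finset.range k ×ˢ Finset.range k).image fun p : ℕ × ℕ =>
    (x₀.1 + s₁ * (2 * (p.1 : ℤ) + 1), x₀.2 + s₂ * (2 * (p.2 : ℤ))), fun y hy => ?_, ?_,
    fun y hy => ?_⟩
  · obtain ⟨h1, h2, h3, h4⟩ := key y hy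
    exact mem_patchOdd.mpr ⟨mem_window.mpr ⟨h2, h1.trans hrη⟩, h4⟩
  · rw [hc]
    push_cast
    calc (r * N) ^ 2 / 16 = (r * N / 4) ^ 2 := by ring
      _ ≤ (k : ℝ) ^ 2 := pow_le_pow_left₀ (by linarith) hk 2
  · obtain ⟨h1, h2, h3, h4⟩ := key y hy
    exact ⟨h1, mem_window.mpr ⟨h2, h1.trans hrh⟩, h3⟩

theorem card_patchOdd_le (hN : 0 < N) (hη : 1 ≤ η * N) :
    ((patchOdd N x₀ x η).card : ℝ) ≤ (3 * (η * N)) ^ 2 := by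
  set k := ⌊η * N⌋₊
  have hsub : patchOdd N x₀ x η ⊆
      Finset.Icc (x.1 - k) (x.1 + k) ×ˢ Finset.Icc (x.2 - k) (x.2 + k) := by
    intro y hy
    have h1 := (norm_pos_sub_pos_le_iff hN).mp (mem_window.mp (mem_patchOdd.mp hy).1).2
    have hfl : ∀ t : ℤ, |(t : ℝ)| ≤ η * N → |t| ≤ k := by
      intro t ht
      have : t.natAbs ≤ k := by
        apply Nat.le_floor
        rwa [Nat.cast_natAbs, Int.cast_abs]
      rw [Int.abs_eq_natAbs]
      exact_mod_cast this
    have h2 := abs_le.mp (hfl _ h1.1)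
    have h3 := abs_le.mp (hfl _ h1.2)
    simp only [Finset.mem_product, Finset.mem_Icc]
    omega
  have hk : (k : ℝ) ≤ η * N := Nat.floor_le (by linarith)
  have hcard := Finset.card_le_card hsub
  have hI : ∀ z : ℤ, (Finset.Icc (z - k) (z + k)).card = 2 * k + 1 := by
    intro z; rw [Int.card_Icc]; omega
  rw [Finset.card_product, hI, hI] at hcard
  calc ((patchOdd N x₀ x η).card : ℝ) ≤ (2 * k + 1) * (2 * k + 1) := by exact_mod_cast hcard
    _ = (2 * k + 1) ^ 2 := by ring
    _ ≤ _ := pow_le_pow_left₀ (by positivity) (by linarith) 2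

end Geometry

/-! ### Estimated similarity versus true squared bias. -/

section Similarity

variable {N : ℕ} {x₀ x : ℤ × ℤ} {h η σ : ℝ} {Y : ℤ × ℤ → ℝ}

/-- The sum of squares in the patch distance. -/
def patchSqSum (N : ℕ) (Y : ℤ × ℤ → ℝ) (x₀ : ℤ × ℤ) (η : ℝ) (x : ℤ × ℤ) : ℝ :=
  ∑ y ∈ patchOdd N x₀ x₀ η, (Y (x + (y - x₀)) - Y y) ^ 2

theorem patchSqSum_nonneg : 0 ≤ patchSqSum N Y x₀ η x := Finset.sum_nonneg fun _ _ => sq_nonneg _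

theorem patchDist_eq (hPI : PatchesInside N x₀ h η) (hx₀ : x₀ ∈ grid N) (hh : 0 ≤ h)
    (hx : x ∈ searchEven N x₀ h) :
    patchDist N Y x₀ η x = √(patchSqSum N Y x₀ η x / (patchOdd N x₀ x₀ η).card) := by
  rw [patchDist, card_patchOdd hPI hx₀ hh hx, Real.sqrt_div patchSqSum_nonneg, patchSqSum]
  ring

theorem rhoHat_nonneg : 0 ≤ rhoHat N σ Y x₀ η x := le_max_right _ _

theorem rhoHat_self (hσ : 0 ≤ σ) : rhoHat N σ Y x₀ η x₀ = 0 := by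
  have : patchDist N Y x₀ η x₀ = 0 := by simp [patchDist]
  rw [rhoHat, this, max_eq_right]
  have := mul_nonneg (Real.sqrt_nonneg 2) hσ
  linarith

/-- The elementary bound `√(s² + a) ≤ s + a / s` with `s = √2 σ`: around a positive noise level, the
root is linear in the excess `a`. -/
theorem rhoHat_le (hPI : PatchesInside N x₀ h η) (hx₀ : x₀ ∈ grid N) (hh : 0 ≤ h)
    (hx : x ∈ searchEven N x₀ h) (hσ : 0 < σ) (hm : 0 < (patchOdd N x₀ x₀ η).card) {a : ℝ}
    (ha : 0 ≤ a)
    (hS : patchSqSum N Y x₀ η x ≤ (patchOdd N x₀ x₀ η).card * (2 * σ ^ 2 + a)) :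
    rhoHat N σ Y x₀ η x ≤ a / (√2 * σ) := by
  have hm' : (0 : ℝ) < (patchOdd N x₀ x₀ η).card := by exact_mod_cast hm
  have hs : 0 < √2 * σ := by positivity
  have hs2 : (√2 * σ) ^ 2 = 2 * σ ^ 2 := by rw [mul_pow, Real.sq_sqrt (by norm_num)]
  refine max_le ?_ (by positivity)
  rw [patchDist_eq hPI hx₀ hh hx, sub_le_iff_le_add]
  apply Real.sqrt_le_iff.mpr
  refine ⟨by positivity, ?_⟩
  calc patchSqSum N Y x₀ η x / (patchOdd N x₀ x₀ η).card ≤ 2 * σ ^ 2 + a := by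
        rw [div_le_iff₀ hm']; linarith
    _ ≤ (a / (√2 * σ)) ^ 2 + 2 * a + (√2 * σ) ^ 2 := by
        rw [hs2]; nlinarith [sq_nonneg (a / (√2 * σ))]
    _ = (a / (√2 * σ) + √2 * σ) ^ 2 := by field_simp; ring

theorem patchSqSum_le (hPI : PatchesInside N x₀ h η) (hx₀ : x₀ ∈ grid N) (hh : 0 ≤ h)
    (hx : x ∈ searchEven N x₀ h) (hm : 0 < (patchOdd N x₀ x₀ η).card) :
    patchSqSum N Y x₀ η x ≤ (patchOdd N x₀ x₀ η).card *
      (rhoHat N σ Y x₀ η x ^ 2 + 2 * (√2 * σ) * rhoHat N σ Y x₀ η x + 2 * σ ^ 2) := by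
  have hm' : (0 : ℝ) < (patchOdd N x₀ x₀ η).card := by exact_mod_cast hm
  have hs2 : (√2 * σ) ^ 2 = 2 * σ ^ 2 := by rw [mul_pow, Real.sq_sqrt (by norm_num)]
  have h1 : √(patchSqSum N Y x₀ η x / (patchOdd N x₀ x₀ η).card) ≤
      rhoHat N σ Y x₀ η x + √2 * σ := by
    rw [← patchDist_eq hPI hx₀ hh hx, ← sub_le_iff_le_add]
    exact le_max_left _ _
  have h2 := (Real.sqrt_le_iff.mp h1).2
  rw [div_le_iff₀ hm'] at h2
  rw [← hs2]
  linarith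

/-- The squared bias at `x` is controlled by the estimated similarity. -/
theorem sq_sub_le {f : ℝ × ℝ → ℝ} {β L r κ t M : ℝ} (hN : 0 < N) (hL : 0 < L) (hβ : 0 < β)
    (hPI : PatchesInside N x₀ h η) (hx₀ : x₀ ∈ grid N) (hh : 0 ≤ h) (hσ : 0 < σ)
    (hf : HolderOnPixels N f β L (window N x₀ h)) (hrh : r ≤ h) (hrη : r ≤ η) (hr : 4 ≤ r * N)
    (hκ : (patchOdd N x₀ x₀ η).card ≤ κ * ((r * N) ^ 2 / 16)) (hM : L * h ^ β ≤ M) (ht : 0 ≤ t)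
    (hx : x ∈ searchEven N x₀ h)
    (hS : (patchOdd N x₀ x₀ η).card * (2 * σ ^ 2 - t) +
      patchSqSum N (fun p => f (pos N p)) x₀ η x / 2 ≤ patchSqSum N Y x₀ η x) :
    (f (pos N x) - f (pos N x₀)) ^ 2 ≤
      (4 * κ * (1 + 2 * (√2 * σ)) + M ^ 2) * rhoHat N σ Y x₀ η x +
        (4 * κ * t + 8 * (L * r ^ β) ^ 2) := by
  have hxw := (mem_searchEven.mp hx).1
  have hx₀w := mem_window_self hx₀ hh
  have hN' : (0 : ℝ) < N := by exact_mod_cast hN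
  have hr0 : 0 < r := by
    by_contra hcon
    nlinarith [mul_nonpos_of_nonpos_of_nonneg (not_lt.mp hcon) hN'.le]
  obtain ⟨Q, hQV, hQ, hQ'⟩ := exists_subset_patchOdd hN hx₀ hPI hh hrh hrη hr hxw
  have hrN : 0 < (r * N) ^ 2 / 16 := by positivity
  have hQ0 : (0 : ℝ) < Q.card := hrN.trans_le hQ
  have hm : 0 < (patchOdd N x₀ x₀ η).card :=
    (by exact_mod_cast hQ0 : 0 < Q.card).trans_le (Finset.card_le_card hQV)
  have hm' : (0 : ℝ) < (patchOdd N x₀ x₀ η).card := by exact_mod_cast hm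
  have hκ0 : 0 < κ := by
    by_contra hcon
    nlinarith [mul_nonpos_of_nonpos_of_nonneg (not_lt.mp hcon) hrN.le]
  set ρ := rhoHat N σ Y x₀ η x
  have hρ : 0 ≤ ρ := rhoHat_nonneg
  set s := √2 * σ
  have hs : 0 < s := by positivity
  set d := f (pos N x) - f (pos N x₀)
  set D := patchSqSum N (fun p => f (pos N p)) x₀ η x
  -- The noise level `2σ²` cancels between the lower deviation bound and the bound of `S` through
  -- `ρ`.
  have hDle : D ≤ 2 * (patchOdd N x₀ x₀ η).card * (ρ ^ 2 + 2 * s * ρ + t) := by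
    have := patchSqSum_le (σ := σ) (Y := Y) hPI hx₀ hh hx hm
    linarith
  have hdM : d ^ 2 ≤ M ^ 2 := by
    rw [← sq_abs]
    refine pow_le_pow_left₀ (abs_nonneg _) (le_trans ((hf x hxw x₀ hx₀w).trans ?_) hM) 2
    gcongr
    exact (mem_window.mp hxw).2
  -- On `Q` all four pixels lie in the search window, so the patch difference is within `2 L r ^ β`
  -- of `d`.
  have hpt : ∀ y ∈ Q, d ^ 2 - 8 * (L * r ^ β) ^ 2 ≤
      2 * (f (pos N (x + (y - x₀))) - f (pos N y)) ^ 2 := by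
    intro y hy
    obtain ⟨h1, h2, h3⟩ := hQ' y hy
    have e1 : |f (pos N (x + (y - x₀))) - f (pos N x)| ≤ L * r ^ β := by
      refine (hf _ h3 _ hxw).trans ?_
      rw [pos_translate_sub]
      gcongr
    have e2 : |f (pos N y) - f (pos N x₀)| ≤ L * r ^ β := by
      refine (hf _ h2 _ hx₀w).trans ?_
      gcongr
    obtain ⟨e3, e4⟩ := abs_le.mp e1
    obtain ⟨e5, e6⟩ := abs_le.mp e2
    set u := f (pos N (x + (y - x₀))) - f (pos N y)
    have e7 : |d - u| ≤ 2 * (L * r ^ β) := by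
      apply abs_le.mpr
      constructor <;> simp only [d, u] <;> linarith
    have e8 : (d - u) ^ 2 ≤ (2 * (L * r ^ β)) ^ 2 := sq_le_sq' (abs_le.mp e7).1 (abs_le.mp e7).2
    nlinarith [sq_nonneg (d - 2 * u)]
  -- Patch pixels outside `Q`, where `f` may be uncontrolled, only contribute nonnegative terms to
  -- `D`.
  have hsum : Q.card * (d ^ 2 - 8 * (L * r ^ β) ^ 2) ≤ 2 * D := by
    have h1 := Finset.sum_le_sum hpt
    rw [Finset.sum_const, nsmul_eq_mul, ← Finset.mul_sum] at h1
    refine h1.trans ?_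
    gcongr
    exact Finset.sum_le_sum_of_subset_of_nonneg hQV fun _ _ _ => sq_nonneg _
  set z := ρ ^ 2 + 2 * s * ρ + t
  have hz : 0 ≤ z := by positivity
  have hmain : d ^ 2 - 8 * (L * r ^ β) ^ 2 ≤ 4 * κ * z := by
    have h1 : Q.card * (d ^ 2 - 8 * (L * r ^ β) ^ 2) ≤ Q.card * (4 * κ * z) := by
      calc _ ≤ 2 * D := hsum
        _ ≤ 4 * (patchOdd N x₀ x₀ η).card * z := by linarith
        _ ≤ 4 * (κ * Q.card) * z := by
          gcongr
          exact hκ.trans (by gcongr)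
        _ = _ := by ring
    exact le_of_mul_le_mul_left h1 hQ0
  -- The quadratic term must be made linear in `ρ`: for `ρ ≤ 1` use `ρ² ≤ ρ`, and for `ρ ≥ 1` the
  -- trivial bound `d² ≤ M²` suffices.
  rcases le_total ρ 1 with h1 | h1
  · have h2 : ρ ^ 2 ≤ ρ := by nlinarith
    have h3 : 4 * κ * z ≤ 4 * κ * (ρ + 2 * s * ρ + t) :=
      mul_le_mul_of_nonneg_left (by simp only [z]; linarith) (by positivity)
    have h4 : 0 ≤ M ^ 2 * ρ := by positivity
    linarith
  · have h2 : M ^ 2 ≤ M ^ 2 * ρ := le_mul_of_one_le_right (sq_nonneg _) h1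
    have h3 : 0 ≤ 4 * κ * (1 + 2 * s) * ρ := by positivity
    have h4 : 0 ≤ 4 * κ * t + 8 * (L * r ^ β) ^ 2 := by positivity
    linarith

end Similarity

/-! ### Deterministic bounds on bias and variance of the weights. -/

section Weights

variable {s : Finset (ℤ × ℤ)} {σ : ℝ} {ρ : ℤ × ℤ → ℝ} {w : s → ℝ}

/-- The minimal objective is at most its value at the uniform weights on a subset. -/
theorem IsOptimalWeight.objective_le (hw : IsOptimalWeight s σ ρ w) {T : Finset (ℤ × ℤ)}
    (hT : T ⊆ s) (hT0 : T.Nonempty) {b : ℝ} (hρ : ∀ x ∈ T, 0 ≤ ρ x) (hb : ∀ x ∈ T, ρ x ≤ b) :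
    objective s σ ρ w ≤ b ^ 2 + σ ^ 2 / T.card := by
  have hc : (0 : ℝ) < T.card := by exact_mod_cast hT0.card_pos
  let v : ℤ × ℤ → ℝ := fun x => if x ∈ T then (1 : ℝ) / T.card else 0
  have hsum : ∀ g : ℤ × ℤ → ℝ, ∑ x : s, v x * g x = (∑ x ∈ T, g x) / T.card := by
    intro g
    rw [Finset.sum_coe_sort s fun x => v x * g x]
    simp only [v, ite_mul, zero_mul]
    rw [Finset.sum_ite_mem, Finset.inter_eq_right.mpr hT, Finset.sum_div]
    exact Finset.sum_congr rfl fun x _ => by ring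
  have hv : (fun x : s => v x) ∈ stdSimplex ℝ s := by
    refine ⟨fun x => ?_, ?_⟩
    · simp only [v]
      split_ifs <;> positivity
    · have := hsum fun _ => 1
      simp only [mul_one, Finset.sum_const, nsmul_eq_mul] at this
      rw [this]
      field_simp
  refine (hw.2 _ hv).trans ?_
  have h1 : ∑ x : s, v x ^ 2 = 1 / T.card := by
    have := hsum v
    simp only [← sq] at this
    rw [this]
    have h2 : ∑ x ∈ T, v x = 1 := by
      rw [Finset.sum_congr rfl fun x hx => if_pos hx, Finset.sum_const, nsmul_eq_mul]
      field_simp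
    rw [h2]
  unfold objective
  rw [hsum, h1]
  have h3 : (∑ x ∈ T, ρ x) / T.card ≤ b := by
    rw [div_le_iff₀ hc, mul_comm, ← nsmul_eq_mul]
    exact Finset.sum_le_card_nsmul _ _ _ hb
  have h4 : 0 ≤ (∑ x ∈ T, ρ x) / T.card := div_nonneg (Finset.sum_nonneg hρ) hc.le
  rw [mul_one_div]
  gcongr

theorem sq_sum_mul_le_of_mem_stdSimplex {ι : Type*} [Fintype ι] {w : ι → ℝ}
    (hw : w ∈ stdSimplex ℝ ι) (g : ι → ℝ) : (∑ x, w x * g x) ^ 2 ≤ ∑ x, w x * g x ^ 2 :=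
  Real.pow_arith_mean_le_arith_mean_pow_of_even _ _ _ (fun i _ => hw.1 i) hw.2 even_two

/-- Bias and variance bound for the optimal weights, when the squared bias at each point is
controlled by an affine function of `ρ`. -/
theorem IsOptimalWeight.sq_bias_add_le (hw : IsOptimalWeight s σ ρ w) {T : Finset (ℤ × ℤ)}
    (hT : T ⊆ s) (hT0 : T.Nonempty) {b K₁ K₂ : ℝ} (hρ : ∀ x ∈ s, 0 ≤ ρ x) (hb : ∀ x ∈ T, ρ x ≤ b)
    (hK₁ : 0 ≤ K₁) {g : ℤ × ℤ → ℝ} (hg : ∀ x ∈ s, g x ^ 2 ≤ K₁ * ρ x + K₂) :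
    (∑ x : s, w x * g x) ^ 2 + σ ^ 2 * ∑ x : s, w x ^ 2 ≤
      K₁ * √(b ^ 2 + σ ^ 2 / T.card) + K₂ + (b ^ 2 + σ ^ 2 / T.card) := by
  have hobj := hw.objective_le hT hT0 (fun x hx => hρ x (hT hx)) hb
  unfold objective at hobj
  set A := b ^ 2 + σ ^ 2 / T.card
  have h0 : 0 ≤ ∑ x : s, w x ^ 2 := Finset.sum_nonneg fun _ _ => sq_nonneg _
  have h1 : ∑ x : s, w x * ρ x ≤ √A := by
    apply Real.le_sqrt_of_sq_le
    nlinarith [mul_nonneg (sq_nonneg σ) h0]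
  have h2 : (∑ x : s, w x * g x) ^ 2 ≤ K₁ * √A + K₂ := by
    -- Jensen, then the affine majorant. As `ρ` enters linearly, the bound is of order `√A` rather
    -- than `A`, which determines the final rate.
    calc (∑ x : s, w x * g x) ^ 2 ≤ ∑ x : s, w x * g x ^ 2 :=
          sq_sum_mul_le_of_mem_stdSimplex hw.1 fun x : s => g x
      _ ≤ ∑ x : s, w x * (K₁ * ρ x + K₂) :=
          Finset.sum_le_sum fun x _ => mul_le_mul_of_nonneg_left (hg x x.2) (hw.1.1 x)
      _ = K₁ * ∑ x : s, w x * ρ x + K₂ * ∑ x : s, w x := by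
          rw [Finset.mul_sum, Finset.mul_sum, ← Finset.sum_add_distrib]
          exact Finset.sum_congr rfl fun x _ => by ring
      _ ≤ K₁ * √A + K₂ := by
          rw [hw.1.2, mul_one]
          gcongr
  nlinarith [sq_nonneg (∑ x : s, w x * ρ x)]

/-- Crude bound for bias and variance of any weights. -/
theorem sq_bias_add_le_of_mem_stdSimplex (hw : w ∈ stdSimplex ℝ s) {M : ℝ} {g : ℤ × ℤ → ℝ}
    (hg : ∀ x ∈ s, g x ^ 2 ≤ M) :
    (∑ x : s, w x * g x) ^ 2 + σ ^ 2 * ∑ x : s, w x ^ 2 ≤ M + σ ^ 2 := by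
  have h1 : (∑ x : s, w x * g x) ^ 2 ≤ M := by
    calc (∑ x : s, w x * g x) ^ 2 ≤ ∑ x : s, w x * g x ^ 2 :=
          sq_sum_mul_le_of_mem_stdSimplex hw fun x : s => g x
      _ ≤ ∑ x : s, w x * M :=
          Finset.sum_le_sum fun x _ => mul_le_mul_of_nonneg_left (hg x x.2) (hw.1 x)
      _ = M := by rw [← Finset.sum_mul, hw.2, one_mul]
  have h2 : ∑ x : s, w x ^ 2 ≤ 1 := by
    rw [← hw.2]
    refine Finset.sum_le_sum fun x _ => ?_
    have h3 : w x ≤ 1 := by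
      rw [← hw.2]
      exact Finset.single_le_sum (fun i _ => hw.1 i) (Finset.mem_univ x)
    nlinarith [hw.1 x]
  nlinarith [sq_nonneg σ]

end Weights

/-! ### Sample splitting: independence of weights and averaged noise. -/

/-- A weighted sum of uncorrelated variables, with random weights bounded by one which are
independent of them, has second moment `v E ∑ w²`. -/
theorem integral_sq_sum_mul_eq {Ω ι : Type*} [MeasurableSpace Ω] {μ : Measure Ω}
    [IsProbabilityMeasure μ] [Fintype ι] [DecidableEq ι] {w e : ι → Ω → ℝ} {v : ℝ}
    (hw : ∀ i, Measurable (w i)) (hw1 : ∀ i ω, |w i ω| ≤ 1) (he : ∀ i, MemLp (e i) 2 μ)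
    (hcov : ∀ i j, ∫ ω, e i ω * e j ω ∂μ = if i = j then v else 0)
    (hind : ∀ i j, IndepFun (fun ω => w i ω * w j ω) (fun ω => e i ω * e j ω) μ) :
    Integrable (fun ω => (∑ i, w i ω * e i ω) ^ 2) μ ∧
      ∫ ω, (∑ i, w i ω * e i ω) ^ 2 ∂μ = v * ∫ ω, ∑ i, w i ω ^ 2 ∂μ := by
  have hww : ∀ i j ω, |w i ω * w j ω| ≤ 1 := fun i j ω => by
    rw [abs_mul]; exact mul_le_one₀ (hw1 i ω) (abs_nonneg _) (hw1 j ω)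
  have hwwi : ∀ i j, Integrable (fun ω => w i ω * w j ω) μ := fun i j =>
    Integrable.of_bound ((hw i).mul (hw j)).aestronglyMeasurable 1
      (Filter.Eventually.of_forall fun ω => hww i j ω)
  have hee : ∀ i j, Integrable (fun ω => e i ω * e j ω) μ := fun i j =>
    (he i).integrable_mul (he j)
  have hexp : (fun ω => (∑ i, w i ω * e i ω) ^ 2) =
      fun ω => ∑ i, ∑ j, (w i ω * w j ω) * (e i ω * e j ω) := by
    funext ω
    rw [sq, Finset.sum_mul_sum]
    exact Finset.sum_congr rfl fun i _ => Finset.sum_congr rfl fun j _ => by ring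
  have hint : ∀ i j, Integrable (fun ω => (w i ω * w j ω) * (e i ω * e j ω)) μ := fun i j =>
    (hee i j).bdd_mul ((hw i).mul (hw j)).aestronglyMeasurable
      (Filter.Eventually.of_forall fun ω => hww i j ω)
  rw [hexp]
  refine ⟨integrable_finsetSum _ fun i _ => integrable_finsetSum _ fun j _ => hint i j, ?_⟩
  rw [integral_finsetSum _ fun i _ => integrable_finsetSum _ fun j _ => hint i j,
    integral_finsetSum _ fun i _ => by simpa only [sq] using hwwi i i, Finset.mul_sum]
  refine Finset.sum_congr rfl fun i _ => ?_
  rw [integral_finsetSum _ fun j _ => hint i j]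
  have : ∀ j, ∫ ω, (w i ω * w j ω) * (e i ω * e j ω) ∂μ =
      (∫ ω, w i ω * w j ω ∂μ) * if i = j then v else 0 := fun j => by
    rw [(hind i j).integral_fun_mul_eq_mul_integral (hwwi i j).aestronglyMeasurable
      (hee i j).aestronglyMeasurable, hcov]
  simp_rw [this]
  simp only [mul_ite, mul_zero, Finset.sum_ite_eq, Finset.mem_univ, if_true]
  simp only [← sq]
  ring

section Split

variable {N : ℕ} {x₀ : ℤ × ℤ} {h η σ : ℝ} {f : ℝ × ℝ → ℝ}

/-- The pixels of the image with even displacement from `x₀`, as a set of noise indices. -/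
def evenIndices (N : ℕ) (x₀ : ℤ × ℤ) : Finset {p : ℤ × ℤ // p ∈ grid N} :=
  Finset.univ.filter fun p => Even ((p.1.1 - x₀.1) + (p.1.2 - x₀.2))

/-- The pixels of the image with odd displacement from `x₀`, as a set of noise indices. -/
def oddIndices (N : ℕ) (x₀ : ℤ × ℤ) : Finset {p : ℤ × ℤ // p ∈ grid N} :=
  Finset.univ.filter fun p => ¬ Even ((p.1.1 - x₀.1) + (p.1.2 - x₀.2))

theorem measurable_rhoHat (N : ℕ) (σ : ℝ) (x₀ x : ℤ × ℤ) (η : ℝ) :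
    Measurable fun Y : ℤ × ℤ → ℝ => rhoHat N σ Y x₀ η x := by
  unfold rhoHat patchDist
  fun_prop

/-- For even `x`, translation by `x - x₀` preserves parity, so both patches read the image at odd
pixels only. -/
theorem rhoHat_congr (hPI : PatchesInside N x₀ h η) {x : ℤ × ℤ} (hx : x ∈ searchEven N x₀ h)
    {Y Y' : ℤ × ℤ → ℝ}
    (hY : ∀ p ∈ grid N, ¬ Even ((p.1 - x₀.1) + (p.2 - x₀.2)) → Y p = Y' p) :
    rhoHat N σ Y x₀ η x = rhoHat N σ Y' x₀ η x := by
  unfold rhoHat patchDist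
  rw [Finset.sum_congr rfl fun y hy => ?_]
  have h1 := mem_patchOdd.mp hy
  have h2 := mem_patchOdd.mp (translate_mem_patchOdd hPI hx hy)
  rw [hY y (mem_window.mp h1.1).1 h1.2, hY _ (mem_window.mp h2.1).1 h2.2]

/-- The weights are a measurable function of the noise at the odd pixels. -/
theorem exists_measurable_weights (hx₀ : x₀ ∈ grid N) (hPI : PatchesInside N x₀ h η)
    (hh : 0 ≤ h) (hσ : 0 < σ) :
    ∃ Ψ : (oddIndices N x₀ → ℝ) → (searchEven N x₀ h → ℝ), Measurable Ψ ∧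
      ∀ e : ℤ × ℤ → ℝ, optimalWeight (searchEven N x₀ h) σ
        (rhoHat N σ (fun p => f (pos N p) + e p) x₀ η) = Ψ fun i => e i := by
  have hne : (searchEven N x₀ h).Nonempty :=
    ⟨x₀, mem_searchEven.mpr ⟨mem_window_self hx₀ hh, by simp⟩⟩
  -- The image is rebuilt from the odd noise; the value `0` at all other pixels is never read.
  let E : (oddIndices N x₀ → ℝ) → ℤ × ℤ → ℝ := fun e p =>
    if hp : p ∈ grid N ∧ ¬ Even ((p.1 - x₀.1) + (p.2 - x₀.2)) then
      f (pos N p) + e ⟨⟨p, hp.1⟩, by simpa [oddIndices] using hp.2⟩ else 0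
  have hE : Measurable E := by
    refine measurable_pi_iff.mpr fun p => ?_
    simp only [E]
    split_ifs <;> fun_prop
  refine ⟨fun e => optimalWeight (searchEven N x₀ h) σ (rhoHat N σ (E e) x₀ η), ?_, fun e => ?_⟩
  · refine (continuous_optimalWeight _ hne hσ).measurable.comp (measurable_pi_iff.mpr fun x => ?_)
    exact (measurable_rhoHat N σ x₀ x η).comp hE
  · refine optimalWeight_congr σ fun x hx => rhoHat_congr hPI hx fun p hp hodd => ?_
    simp only [E]
    rw [dif_pos ⟨hp, hodd⟩]

variable {Ω : Type*} [MeasurableSpace Ω] {μ : Measure Ω} {ε : ℤ × ℤ → Ω → ℝ}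

theorem IsGaussianNoise.memLp (hε : IsGaussianNoise N σ ε μ) {p : ℤ × ℤ} (hp : p ∈ grid N) :
    MemLp (ε p) 2 μ := by
  have h1 := hε.1 p hp
  have h2 : MemLp id 2 (gaussianReal 0 (σ ^ 2).toNNReal) := memLp_id_gaussianReal' 2 (by simp)
  rw [← h1.map_eq] at h2
  exact (memLp_map_measure_iff (by fun_prop) h1.aemeasurable).mp h2

theorem IsGaussianNoise.integral_eq_zero (hε : IsGaussianNoise N σ ε μ) {p : ℤ × ℤ}
    (hp : p ∈ grid N) : ∫ ω, ε p ω ∂μ = 0 := by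
  have h1 := hε.1 p hp
  rw [h1.integral_eq, integral_id_gaussianReal]

theorem IsGaussianNoise.integral_mul (hε : IsGaussianNoise N σ ε μ) {p q : ℤ × ℤ}
    (hp : p ∈ grid N) (hq : q ∈ grid N) :
    ∫ ω, ε p ω * ε q ω ∂μ = if p = q then σ ^ 2 else 0 := by
  split_ifs with hpq
  · subst hpq
    have h1 := hε.1 p hp
    have h2 := h1.variance_eq
    rw [variance_id_gaussianReal, variance_eq_integral h1.aemeasurable,
      hε.integral_eq_zero hp, Real.coe_toNNReal _ (sq_nonneg σ)] at h2
    rw [← h2]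
    simp [sq]
  · have hI : IndepFun (ε p) (ε q) μ :=
      hε.2.indepFun (i := ⟨p, hp⟩) (j := ⟨q, hq⟩) (by simpa using hpq)
    rw [hI.integral_fun_mul_eq_mul_integral (hε.memLp hp).aestronglyMeasurable
      (hε.memLp hq).aestronglyMeasurable, hε.integral_eq_zero hp, zero_mul]

/-- The squared risk of the split-sample filter is at most twice the expectation of the squared
bias plus the variance given the weights. -/
theorem integrable_and_integral_sq_error_le [IsProbabilityMeasure μ] (hx₀ : x₀ ∈ grid N)
    (hPI : PatchesInside N x₀ h η) (hh : 0 ≤ h) (hσ : 0 < σ)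
    (hmeas : ∀ p ∈ grid N, Measurable (ε p))
    (hε : IsGaussianNoise N σ ε μ) (W : Ω → searchEven N x₀ h → ℝ)
    (hW : ∀ ω, W ω =
      optimalWeight (searchEven N x₀ h) σ (rhoHat N σ (observe N f ε ω) x₀ η)) :
    (Integrable (fun ω => (splitFilter N σ h η (observe N f ε ω) x₀ - f (pos N x₀)) ^ 2) μ ∧
      ∫ ω, (splitFilter N σ h η (observe N f ε ω) x₀ - f (pos N x₀)) ^ 2 ∂μ ≤
        2 * ∫ ω, ((∑ x : searchEven N x₀ h, W ω x * (f (pos N x) - f (pos N x₀))) ^ 2 +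
          σ ^ 2 * ∑ x : searchEven N x₀ h, W ω x ^ 2) ∂μ) := by
  have hne : (searchEven N x₀ h).Nonempty :=
    ⟨x₀, mem_searchEven.mpr ⟨mem_window_self hx₀ hh, by simp⟩⟩
  have hgrid : ∀ x ∈ searchEven N x₀ h, x ∈ grid N := fun x hx =>
    (mem_window.mp (mem_searchEven.mp hx).1).1
  obtain ⟨Ψ, hΨ, hΨe⟩ := exists_measurable_weights (f := f) (η := η) hx₀ hPI hh hσ
  have hWΨ : ∀ ω, W ω = Ψ fun i => ε i ω := fun ω => by
    rw [hW, ← hΨe fun p => ε p ω]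
    rfl
  have hWS : ∀ ω, W ω ∈ stdSimplex ℝ (searchEven N x₀ h) := fun ω => by
    rw [hW]; exact (optimalWeight_spec _ hne σ hσ _).1
  have hWm : Measurable W := by
    rw [show W = _ from funext hWΨ]
    exact hΨ.comp (measurable_pi_iff.mpr fun i => hmeas _ i.1.2)
  have hWx : ∀ x, Measurable fun ω => W ω x := fun x => (measurable_pi_apply x).comp hWm
  have hW1 : ∀ x ω, |W ω x| ≤ 1 := fun x ω => by
    rw [abs_of_nonneg ((hWS ω).1 x), ← (hWS ω).2]
    exact Finset.single_le_sum (fun i _ => (hWS ω).1 i) (Finset.mem_univ x)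
  have hdisj : Disjoint (oddIndices N x₀) (evenIndices N x₀) := by
    rw [Finset.disjoint_left]
    intro p hp hp'
    simp only [oddIndices, evenIndices, Finset.mem_filter] at hp hp'
    exact hp.2 hp'.2
  have hOE := hε.2.indepFun_finset _ _ hdisj fun i => hmeas _ i.2
  have hmemE : ∀ x : searchEven N x₀ h,
      (⟨x, hgrid x x.2⟩ : {p : ℤ × ℤ // p ∈ grid N}) ∈ evenIndices N x₀ := fun x => by
    simp only [evenIndices, Finset.mem_filter, Finset.mem_univ, true_and]
    exact (mem_searchEven.mp x.2).2
  obtain ⟨hint, heq⟩ := integral_sq_sum_mul_eq (μ := μ) (w := fun x ω => W ω x)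
    (e := fun (x : searchEven N x₀ h) ω => ε x ω) (v := σ ^ 2) hWx hW1
    (fun x => hε.memLp (hgrid x x.2))
    (fun x y => by
      rw [hε.integral_mul (hgrid x x.2) (hgrid y y.2)]
      simp only [Subtype.ext_iff])
    (fun x y => by
      have := hOE.comp (φ := fun e => Ψ e x * Ψ e y)
        (ψ := fun e => e ⟨_, hmemE x⟩ * e ⟨_, hmemE y⟩)
        (((measurable_pi_apply x).comp hΨ).mul ((measurable_pi_apply y).comp hΨ)) (by fun_prop)
      simp only [hWΨ]
      exact this)
  set g : ℤ × ℤ → ℝ := fun x => f (pos N x) - f (pos N x₀)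
  have hsplit : ∀ ω, splitFilter N σ h η (observe N f ε ω) x₀ - f (pos N x₀) =
      ∑ x : searchEven N x₀ h, W ω x * g x + ∑ x : searchEven N x₀ h, W ω x * ε x ω := by
    intro ω
    have h1 := (hWS ω).2
    rw [splitFilter, ← hW, ← Finset.sum_add_distrib]
    have h2 : f (pos N x₀) = ∑ x : searchEven N x₀ h, W ω x * f (pos N x₀) := by
      rw [← Finset.sum_mul, h1, one_mul]
    rw [h2, ← Finset.sum_sub_distrib]
    refine Finset.sum_congr rfl fun x _ => ?_
    simp only [g, observe]
    ring
  have hBm : Measurable fun ω => (∑ x : searchEven N x₀ h, W ω x * g x) ^ 2 :=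
    (Finset.measurable_fun_sum _ fun x _ => (hWx x).mul_const _).pow_const 2
  have hBint : Integrable (fun ω => (∑ x : searchEven N x₀ h, W ω x * g x) ^ 2) μ := by
    refine Integrable.of_bound hBm.aestronglyMeasurable ((∑ x : searchEven N x₀ h, |g x|) ^ 2)
      (Filter.Eventually.of_forall fun ω => ?_)
    rw [norm_pow]
    refine pow_le_pow_left₀ (norm_nonneg _) ((norm_sum_le _ _).trans ?_) 2
    refine Finset.sum_le_sum fun x _ => ?_
    rw [norm_mul, Real.norm_eq_abs, Real.norm_eq_abs]
    exact mul_le_of_le_one_left (abs_nonneg _) (hW1 x ω)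
  have hVint : Integrable (fun ω => ∑ x : searchEven N x₀ h, W ω x ^ 2) μ :=
    integrable_finsetSum _ fun x _ => Integrable.of_bound ((hWx x).pow_const 2).aestronglyMeasurable
      1 (Filter.Eventually.of_forall fun ω => by
        rw [norm_pow]; exact pow_le_one₀ (norm_nonneg _) (hW1 x ω))
  -- The factor `2` avoids having to show that the cross term integrates to zero.
  have hle : ∀ ω, (splitFilter N σ h η (observe N f ε ω) x₀ - f (pos N x₀)) ^ 2 ≤
      2 * ((∑ x : searchEven N x₀ h, W ω x * g x) ^ 2 +
        (∑ x : searchEven N x₀ h, W ω x * ε x ω) ^ 2) := fun ω => by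
    rw [hsplit]
    nlinarith [sq_nonneg (∑ x : searchEven N x₀ h, W ω x * g x -
      ∑ x : searchEven N x₀ h, W ω x * ε x ω)]
  have hfm : Measurable fun ω =>
      (splitFilter N σ h η (observe N f ε ω) x₀ - f (pos N x₀)) ^ 2 := by
    simp only [hsplit]
    refine ((Finset.measurable_fun_sum _ fun x _ => (hWx x).mul_const _).add
      (Finset.measurable_fun_sum _ fun x _ => (hWx x).mul (hmeas _ (hgrid x x.2)))).pow_const 2
  have hdom := (hBint.add hint).const_mul 2
  refine ⟨hdom.mono' hfm.aestronglyMeasurable (Filter.Eventually.of_forall fun ω => ?_), ?_⟩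
  · rw [Real.norm_of_nonneg (sq_nonneg _)]
    exact hle ω
  · have hint2 := hdom.mono' hfm.aestronglyMeasurable (Filter.Eventually.of_forall fun ω => by
      rw [Real.norm_of_nonneg (sq_nonneg _)]
      exact hle ω)
    calc _ ≤ ∫ ω, 2 * ((∑ x : searchEven N x₀ h, W ω x * g x) ^ 2 +
          (∑ x : searchEven N x₀ h, W ω x * ε x ω) ^ 2) ∂μ := integral_mono hint2 hdom hle
      _ = _ := by
        rw [integral_const_mul, integral_add hBint hint, heq,
          integral_add hBint (hVint.const_mul _), integral_const_mul]

end Split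

/-! ### Deviation of the patch distances. -/

/-- Translates by `t ≠ 0` can be coloured with two colours so that `y` and `y + t` differ. -/
theorem exists_alternating_coloring {t : ℤ × ℤ} (ht : t ≠ 0) :
    ∃ χ : ℤ × ℤ → Prop, ∀ y, ¬(χ y ↔ χ (y + t)) := by
  -- The colour is the parity of the integer quotient by a nonzero coordinate of `t`; adding `t`
  -- raises that quotient by one.
  have key : ∀ c a : ℤ, c ≠ 0 → ¬(Even (a / c) ↔ Even ((a + c) / c)) := by
    intro c a hc
    rw [Int.add_ediv_of_dvd_right (dvd_refl c), Int.ediv_self hc, Int.even_add_one]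
    tauto
  by_cases h1 : t.1 = 0
  · have h2 : t.2 ≠ 0 := fun h2 => ht (Prod.ext h1 h2)
    exact ⟨fun y => Even (y.2 / t.2), fun y => key t.2 y.2 h2⟩
  · exact ⟨fun y => Even (y.1 / t.1), fun y => key t.1 y.1 h1⟩

section Deviation

variable {N : ℕ} {x₀ x : ℤ × ℤ} {h η σ : ℝ} {f : ℝ × ℝ → ℝ}
  {Ω : Type*} [MeasurableSpace Ω] {μ : Measure Ω} {ε : ℤ × ℤ → Ω → ℝ}

/-- Two-sided concentration of the squared patch distance. -/
theorem measure_patchSqSum_deviation_le (hPI : PatchesInside N x₀ h η)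
    (hσ : 0 < σ) (hmeas : ∀ p ∈ grid N, Measurable (ε p))
    (hε : IsGaussianNoise N σ ε μ) (hx : x ∈ searchEven N x₀ h) (hne : x ≠ x₀) {θ : ℝ}
    (hθ0 : 0 < θ) (hθ : 4 * θ * (2 * σ ^ 2) ≤ 1 / 2) :
    μ {ω | (patchOdd N x₀ x₀ η).card * (2 * σ ^ 2 + (4 * (2 * σ ^ 2) ^ 2 + 1) * θ) +
          2 * patchSqSum N (fun p => f (pos N p)) x₀ η x ≤
        patchSqSum N (observe N f ε ω) x₀ η x} ≤
      ENNReal.ofReal (Real.exp (-(θ ^ 2 * (patchOdd N x₀ x₀ η).card))) ∧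
    μ {ω | patchSqSum N (observe N f ε ω) x₀ η x ≤
        (patchOdd N x₀ x₀ η).card * (2 * σ ^ 2 - (4 * (2 * σ ^ 2) ^ 2 + 1) * θ) +
          patchSqSum N (fun p => f (pos N p)) x₀ η x / 2} ≤
      ENNReal.ofReal (Real.exp (-(θ ^ 2 * (patchOdd N x₀ x₀ η).card))) := by
  classical
  set V := patchOdd N x₀ x₀ η
  have hV : ∀ y ∈ V, y ∈ grid N := fun y hy => (mem_window.mp (mem_patchOdd.mp hy).1).1
  have hV' : ∀ y ∈ V, x + (y - x₀) ∈ grid N := fun y hy =>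
    (mem_window.mp (mem_patchOdd.mp (translate_mem_patchOdd hPI hx hy)).1).1
  let a : V → {p : ℤ × ℤ // p ∈ grid N} := fun y => ⟨x + (y - x₀), hV' y y.2⟩
  let b : V → {p : ℤ × ℤ // p ∈ grid N} := fun y => ⟨y, hV y y.2⟩
  let Δ : V → ℝ := fun y => f (pos N (x + (y - x₀))) - f (pos N y)
  obtain ⟨χ, hχ⟩ := exists_alternating_coloring (sub_ne_zero.mpr hne)
  have ha : Set.InjOn a (Finset.univ : Finset V) := fun y _ y' _ hyy => by
    have := congrArg Subtype.val hyy
    exact Subtype.ext (by simpa [a] using this)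
  have hb : Set.InjOn b (Finset.univ : Finset V) := fun y _ y' _ hyy => by
    have := congrArg Subtype.val hyy
    exact Subtype.ext (by simpa [b] using this)
  have hab : ∀ y ∈ (Finset.univ : Finset V), a y ≠ b y := fun y _ hyy => hne (by
    have h1 : x + ((y : ℤ × ℤ) - x₀) = y := congrArg Subtype.val hyy
    have h2 : x - x₀ = 0 := by
      have : x - x₀ = x + ((y : ℤ × ℤ) - x₀) - y := by abel
      rw [this, h1, sub_self]
    exact sub_eq_zero.mp h2)
  have hχ' : ∀ y ∈ (Finset.univ : Finset V), ∀ y' ∈ (Finset.univ : Finset V), a y = b y' →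
      ¬(χ y ↔ χ y') := fun y _ y' _ hyy => by
    have h1 : x + ((y : ℤ × ℤ) - x₀) = y' := congrArg Subtype.val hyy
    have h2 := hχ y
    rwa [show (y : ℤ × ℤ) + (x - x₀) = y' by rw [← h1]; abel] at h2
  have hv : (σ ^ 2).toNNReal ≠ 0 := (Real.toNNReal_pos.mpr (by positivity)).ne'
  have hw : 2 * σ ^ 2 = 2 * ((σ ^ 2).toNNReal : ℝ) := by
    rw [Real.coe_toNNReal _ (sq_nonneg σ)]
  have hS : ∀ ω, ∑ y : V, (Δ y + (ε (a y) ω - ε (b y) ω)) ^ 2 =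
      patchSqSum N (observe N f ε ω) x₀ η x := fun ω => by
    rw [patchSqSum, ← Finset.sum_coe_sort V fun y =>
      (observe N f ε ω (x + (y - x₀)) - observe N f ε ω y) ^ 2]
    refine Finset.sum_congr rfl fun y _ => ?_
    simp only [Δ, a, b, observe]
    ring
  have hD : ∑ y : V, Δ y ^ 2 = patchSqSum N (fun p => f (pos N p)) x₀ η x := by
    exact Finset.sum_coe_sort V fun y =>
      (f (pos N (x + (y - x₀))) - f (pos N y)) ^ 2
  have hcard : (Finset.univ : Finset V).card = V.card := by simp
  have h1 := measure_sum_sq_ge_le hε.2 (fun i => hmeas i i.2)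
    (fun i => (hε.1 i i.2).map_eq) hv Finset.univ a b ha hb hab (fun y => χ y) hχ' Δ hw hθ0 hθ
  have h2 := measure_sum_sq_le_le hε.2 (fun i => hmeas i i.2)
    (fun i => (hε.1 i i.2).map_eq) hv Finset.univ a b ha hb hab (fun y => χ y) hχ' Δ hw hθ0 hθ
  simp only [hS, hD, hcard] at h1 h2
  exact ⟨h1, h2⟩

end Deviation

/-! ### Finite-sample risk bound. -/

theorem card_grid (N : ℕ) : (grid N).card = N ^ 2 := by
  simp [grid, sq]

/-- Finite-sample risk bound: all the constants are explicit, and the noise is measurable. -/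
theorem integral_sq_error_le_of_measurable {N : ℕ} {x₀ : ℤ × ℤ} {h η σ : ℝ} {f : ℝ × ℝ → ℝ}
    {Ω : Type*} [MeasurableSpace Ω] {μ : Measure Ω} [IsProbabilityMeasure μ] {ε : ℤ × ℤ → Ω → ℝ}
    {β L r δ κ M θ t b : ℝ} (hN : 0 < N) (hL : 0 < L) (hβ : 0 < β) (hσ : 0 < σ)
    (hx₀ : x₀ ∈ grid N) (hPI : PatchesInside N x₀ h η) (hh : 0 ≤ h)
    (hf : HolderOnPixels N f β L (window N x₀ h)) (hrh : r ≤ h) (hrη : r ≤ η) (hr : 4 ≤ r * N)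
    (hδh : δ ≤ h) (hδη : δ ≤ η) (hδ : 4 ≤ δ * N)
    (hκ : (3 * (η * N)) ^ 2 ≤ κ * ((r * N) ^ 2 / 16)) (hM : L * h ^ β ≤ M)
    (hnear : ∀ x ∈ searchEven N x₀ δ, ∀ y ∈ patchOdd N x₀ x₀ η,
      |f (pos N (x + (y - x₀))) - f (pos N y)| ≤ L * δ ^ β)
    (hθ0 : 0 < θ) (hθ : 4 * θ * (2 * σ ^ 2) ≤ 1 / 2)
    (hθN : 2 * Real.log ((N : ℝ) ^ 2) ≤ θ ^ 2 * ((r * N) ^ 2 / 16))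
    (ht : t = (4 * (2 * σ ^ 2) ^ 2 + 1) * θ) (hb : b = (t + 2 * (L * δ ^ β) ^ 2) / (√2 * σ))
    (hmeas : ∀ p ∈ grid N, Measurable (ε p)) (hε : IsGaussianNoise N σ ε μ) :
    Integrable (fun ω => (splitFilter N σ h η (observe N f ε ω) x₀ - f (pos N x₀)) ^ 2) μ ∧
      ∫ ω, (splitFilter N σ h η (observe N f ε ω) x₀ - f (pos N x₀)) ^ 2 ∂μ ≤
        2 * ((4 * κ * (1 + 2 * (√2 * σ)) + M ^ 2) * √(b ^ 2 + σ ^ 2 / ((δ * N) ^ 2 / 16)) +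
          (4 * κ * t + 8 * (L * r ^ β) ^ 2) + (b ^ 2 + σ ^ 2 / ((δ * N) ^ 2 / 16)) +
          (M ^ 2 + σ ^ 2) * (2 / (N : ℝ) ^ 2)) := by
  have hN' : (0 : ℝ) < N := by exact_mod_cast hN
  have hpos_of : ∀ {r : ℝ}, 4 ≤ r * N → 0 < r := fun {r} hr => by
    by_contra hcon
    nlinarith [mul_nonpos_of_nonpos_of_nonneg (not_lt.mp hcon) hN'.le]
  have hr0 := hpos_of hr
  have hδ0 := hpos_of hδ
  set m := (patchOdd N x₀ x₀ η).card
  have ht0 : 0 < t := by rw [ht]; positivity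
  have hx₀w := mem_window_self hx₀ hh
  have hx₀s : x₀ ∈ searchEven N x₀ h := mem_searchEven.mpr ⟨hx₀w, by simp⟩
  have hmlow : (r * N) ^ 2 / 16 ≤ (m : ℝ) := by
    obtain ⟨Q, hQV, hQ, -⟩ := exists_subset_patchOdd hN hx₀ hPI hh hrh hrη hr hx₀w
    exact hQ.trans (by exact_mod_cast Finset.card_le_card hQV)
  have hm0 : (0 : ℝ) < m := lt_of_lt_of_le (by positivity) hmlow
  have hm : 0 < m := by exact_mod_cast hm0
  have hmκ : (m : ℝ) ≤ κ * ((r * N) ^ 2 / 16) := by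
    refine (card_patchOdd_le hN ?_).trans hκ
    have := mul_le_mul_of_nonneg_right hrη hN'.le
    linarith
  have hκ0 : 0 < κ := by
    by_contra hcon
    nlinarith [mul_nonpos_of_nonpos_of_nonneg (not_lt.mp hcon)
      (by positivity : 0 ≤ (r * N) ^ 2 / 16)]
  set T := searchEven N x₀ δ
  have hTcard : (δ * N) ^ 2 / 16 ≤ T.card := le_card_searchEven hN hx₀ hPI hh hδη hδ
  have hTs : T ⊆ searchEven N x₀ h := fun x hx => by
    rw [mem_searchEven, mem_window] at hx ⊢
    exact ⟨⟨hx.1.1, hx.1.2.trans hδh⟩, hx.2⟩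
  have hT0 : T.Nonempty :=
    ⟨x₀, mem_searchEven.mpr ⟨mem_window_self hx₀ hδ0.le, by simp⟩⟩
  set D : ℤ × ℤ → ℝ := patchSqSum N (fun p => f (pos N p)) x₀ η
  set S : Ω → ℤ × ℤ → ℝ := fun ω => patchSqSum N (observe N f ε ω) x₀ η
  set Bad : ℤ × ℤ → Set Ω := fun x =>
    {ω | m * (2 * σ ^ 2 + t) + 2 * D x ≤ S ω x} ∪ {ω | S ω x ≤ m * (2 * σ ^ 2 - t) + D x / 2}
  -- The centre is excluded because its patch distance is identically zero and does not concentrate;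
  -- there both `ρ̂''` and the bias vanish.
  set B : Set Ω := ⋃ x ∈ (searchEven N x₀ h).erase x₀, Bad x
  set W : Ω → searchEven N x₀ h → ℝ := fun ω =>
    optimalWeight (searchEven N x₀ h) σ (rhoHat N σ (observe N f ε ω) x₀ η)
  set g : ℤ × ℤ → ℝ := fun x => f (pos N x) - f (pos N x₀)
  have hWopt : ∀ ω, IsOptimalWeight (searchEven N x₀ h) σ
      (rhoHat N σ (observe N f ε ω) x₀ η) (W ω) := fun ω =>
    optimalWeight_spec _ ⟨x₀, hx₀s⟩ σ hσ _
  obtain ⟨hint, hle⟩ := integrable_and_integral_sq_error_le hx₀ hPI hh hσ hmeas hε W fun _ => rfl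
  refine ⟨hint, hle.trans (mul_le_mul_of_nonneg_left ?_ zero_le_two)⟩
  set A := (4 * κ * (1 + 2 * (√2 * σ)) + M ^ 2) * √(b ^ 2 + σ ^ 2 / ((δ * N) ^ 2 / 16)) +
          (4 * κ * t + 8 * (L * r ^ β) ^ 2) + (b ^ 2 + σ ^ 2 / ((δ * N) ^ 2 / 16))
  have hA0 : 0 ≤ A := by positivity
  have hg : ∀ x ∈ searchEven N x₀ h, g x ^ 2 ≤ M ^ 2 := fun x hx => by
    rw [← sq_abs]
    have hxw := (mem_searchEven.mp hx).1
    refine pow_le_pow_left₀ (abs_nonneg _) (le_trans ((hf x hxw x₀ hx₀w).trans ?_) hM) 2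
    gcongr
    exact (mem_window.mp hxw).2
  have hgood : ∀ ω ∉ B, (∑ x : searchEven N x₀ h, W ω x * g x) ^ 2 +
      σ ^ 2 * ∑ x : searchEven N x₀ h, W ω x ^ 2 ≤ A := by
    intro ω hω
    have hnot : ∀ x ∈ searchEven N x₀ h, x ≠ x₀ →
        S ω x < m * (2 * σ ^ 2 + t) + 2 * D x ∧ m * (2 * σ ^ 2 - t) + D x / 2 < S ω x := by
      intro x hx hne
      have : ω ∉ Bad x := fun hB =>
        hω (Set.mem_biUnion (Finset.mem_erase.mpr ⟨hne, hx⟩) hB)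
      simpa [Bad, not_or] using this
    refine ((hWopt ω).sq_bias_add_le hTs hT0 (b := b)
      (K₁ := 4 * κ * (1 + 2 * (√2 * σ)) + M ^ 2) (K₂ := 4 * κ * t + 8 * (L * r ^ β) ^ 2)
      (fun x _ => rhoHat_nonneg) ?_ (by positivity) (g := g) ?_).trans ?_
    · intro x hx
      by_cases hne : x = x₀
      · rw [hne, rhoHat_self hσ.le, hb]
        positivity
      · rw [hb]
        refine rhoHat_le hPI hx₀ hh (hTs hx) hσ hm (by positivity) ?_
        have h1 := (hnot x (hTs hx) hne).1
        have h2 : D x ≤ m * (L * δ ^ β) ^ 2 := by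
          simp only [D, patchSqSum, m]
          rw [← nsmul_eq_mul]
          refine Finset.sum_le_card_nsmul _ _ _ fun y hy => ?_
          rw [← sq_abs]
          exact pow_le_pow_left₀ (abs_nonneg _) (hnear x hx y hy) 2
        simp only [S] at h1
        linarith
    · intro x hx
      by_cases hne : x = x₀
      · have h1 : 0 ≤ rhoHat N σ (observe N f ε ω) x₀ η x := rhoHat_nonneg
        have : g x = 0 := by simp [g, hne]
        rw [this, zero_pow two_ne_zero]
        exact add_nonneg (mul_nonneg (by positivity) h1) (by positivity)
      · exact sq_sub_le hN hL hβ hPI hx₀ hh hσ hf hrh hrη hr hmκ hM ht0.le hx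
          (hnot x hx hne).2.le
    · simp only [A]
      gcongr
  have hSm : ∀ x ∈ searchEven N x₀ h, Measurable fun ω => S ω x := fun x hx => by
    refine Finset.measurable_fun_sum _ fun y hy => ?_
    have h1 := hmeas _ (mem_window.mp (mem_patchOdd.mp hy).1).1
    have h2 := hmeas _ (mem_window.mp
      (mem_patchOdd.mp (translate_mem_patchOdd hPI hx hy)).1).1
    unfold observe
    fun_prop
  have hBm : MeasurableSet B := by
    refine Finset.measurableSet_biUnion _ fun x hx => ?_
    have := hSm x (Finset.mem_of_mem_erase hx)
    exact (measurableSet_le measurable_const this).union (measurableSet_le this measurable_const)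
  -- The power `4` leaves `2 / N²` after a union over at most `N²` pixels with two tails each.
  have hexp : Real.exp (-(θ ^ 2 * m)) ≤ 1 / (N : ℝ) ^ 4 := by
    have h1 : 4 * Real.log N ≤ θ ^ 2 * m := by
      have h2 : θ ^ 2 * ((r * N) ^ 2 / 16) ≤ θ ^ 2 * m := by gcongr
      rw [Real.log_pow] at hθN
      push_cast at hθN
      linarith
    calc Real.exp (-(θ ^ 2 * m)) ≤ Real.exp (-(4 * Real.log N)) :=
          Real.exp_le_exp.mpr (by linarith)
      _ = 1 / (N : ℝ) ^ 4 := by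
        rw [Real.exp_neg, mul_comm, Real.exp_mul, Real.exp_log hN', one_div]
        norm_cast
  have hμB : μ.real B ≤ 2 / (N : ℝ) ^ 2 := by
    have h1 : μ B ≤ ENNReal.ofReal (2 / (N : ℝ) ^ 2) := by
      calc μ B ≤ ∑ x ∈ (searchEven N x₀ h).erase x₀, μ (Bad x) := measure_biUnion_finset_le _ _
        _ ≤ ∑ x ∈ (searchEven N x₀ h).erase x₀, ENNReal.ofReal (2 / (N : ℝ) ^ 4) := by
          refine Finset.sum_le_sum fun x hx => ?_
          obtain ⟨hne, hx⟩ := Finset.mem_erase.mp hx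
          obtain ⟨h2, h3⟩ := measure_patchSqSum_deviation_le (f := f) hPI hσ hmeas hε hx hne
            hθ0 hθ
          rw [← ht] at h2 h3
          refine (measure_union_le _ _).trans ((add_le_add h2 h3).trans ?_)
          rw [← ENNReal.ofReal_add (Real.exp_pos _).le (Real.exp_pos _).le]
          refine ENNReal.ofReal_le_ofReal ((add_le_add hexp hexp).trans (le_of_eq ?_))
          ring
        _ = ((searchEven N x₀ h).erase x₀).card * ENNReal.ofReal (2 / (N : ℝ) ^ 4) := by
          rw [Finset.sum_const, nsmul_eq_mul]
        _ ≤ ((N ^ 2 : ℕ) : ℝ≥0∞) * ENNReal.ofReal (2 / (N : ℝ) ^ 4) := by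
          gcongr
          rw [← card_grid]
          exact Finset.card_le_card fun x hx =>
            (mem_window.mp (mem_searchEven.mp (Finset.mem_of_mem_erase hx)).1).1
        _ = ENNReal.ofReal (2 / (N : ℝ) ^ 2) := by
          rw [← ENNReal.ofReal_natCast, ← ENNReal.ofReal_mul (by positivity)]
          congr 1
          push_cast
          field_simp
    exact ENNReal.toReal_le_of_le_ofReal (by positivity) h1
  have hF : ∀ ω, (∑ x : searchEven N x₀ h, W ω x * g x) ^ 2 +
      σ ^ 2 * ∑ x : searchEven N x₀ h, W ω x ^ 2 ≤
        A + B.indicator (fun _ => M ^ 2 + σ ^ 2) ω := by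
    intro ω
    by_cases hω : ω ∈ B
    · rw [Set.indicator_of_mem hω]
      have := sq_bias_add_le_of_mem_stdSimplex (σ := σ) (hWopt ω).1 hg
      linarith
    · rw [Set.indicator_of_notMem hω, add_zero]
      exact hgood ω hω
  have hIint : Integrable (fun ω => A + B.indicator (fun _ => M ^ 2 + σ ^ 2) ω) μ :=
    (integrable_const A).add ((integrable_const _).indicator hBm)
  calc _ ≤ ∫ ω, (A + B.indicator (fun _ => M ^ 2 + σ ^ 2) ω) ∂μ := by
        refine integral_mono_of_nonneg (Filter.Eventually.of_forall fun ω => ?_) hIint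
          (Filter.Eventually.of_forall hF)
        exact add_nonneg (sq_nonneg _)
          (mul_nonneg (sq_nonneg _) (Finset.sum_nonneg fun _ _ => sq_nonneg _))
    _ = A + (M ^ 2 + σ ^ 2) * μ.real B := by
        rw [integral_add (integrable_const A) ((integrable_const _).indicator hBm),
          integral_indicator_const _ hBm]
        simp [mul_comm]
    _ ≤ _ := by gcongr

/-! ### Measurable noise, scales and rates. -/

open Filter Topology

/-- `HasLaw` provides only a.e. measurability, so each variable is replaced by a measurable version;
law, independence and integrals are unaffected. -/
theorem IsGaussianNoise.exists_measurable {N : ℕ} {σ : ℝ} {Ω : Type*} [MeasurableSpace Ω]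
    {μ : Measure Ω} {ε : ℤ × ℤ → Ω → ℝ} (hε : IsGaussianNoise N σ ε μ) :
    ∃ ε' : ℤ × ℤ → Ω → ℝ, (∀ p ∈ grid N, Measurable (ε' p)) ∧ IsGaussianNoise N σ ε' μ ∧
      ∀ᵐ ω ∂μ, ∀ p, ε p ω = ε' p ω := by
  let ε' : ℤ × ℤ → Ω → ℝ := fun p =>
    if hp : p ∈ grid N then (hε.1 p hp).aemeasurable.mk (ε p) else ε p
  have hgrid : ∀ p (hp : p ∈ grid N), ε' p = (hε.1 p hp).aemeasurable.mk (ε p) := fun p hp =>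
    dif_pos hp
  have hae : ∀ p, ε p =ᵐ[μ] ε' p := fun p => by
    by_cases hp : p ∈ grid N
    · rw [hgrid p hp]
      exact (hε.1 p hp).aemeasurable.ae_eq_mk
    · rw [show ε' p = ε p from dif_neg hp]
  refine ⟨ε', fun p hp => ?_, ⟨fun p hp => ?_, ?_⟩, ae_all_iff.mpr hae⟩
  · rw [hgrid p hp]
    exact (hε.1 p hp).aemeasurable.measurable_mk
  · exact (hε.1 p hp).congr (hae p).symm
  · exact hε.2.congr fun p => hae p

/-- The Hölder condition compares the patches at `x₀` and at nearby points. -/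
theorem abs_translate_sub_le {N : ℕ} {x₀ x y : ℤ × ℤ} {h η δ r β L : ℝ} {f : ℝ × ℝ → ℝ}
    (hL : 0 ≤ L) (hβ : 0 ≤ β) (hPI : PatchesInside N x₀ h η) (hδ : 0 ≤ δ) (hδh : δ ≤ h)
    (hr : δ + η ≤ r) (hf : HolderOnPixels N f β L (window N x₀ r))
    (hx : x ∈ searchEven N x₀ δ) (hy : y ∈ patchOdd N x₀ x₀ η) :
    |f (pos N (x + (y - x₀))) - f (pos N y)| ≤ L * δ ^ β := by
  have hx' := mem_window.mp (mem_searchEven.mp hx).1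
  have hy' := mem_window.mp (mem_patchOdd.mp hy).1
  have hp : x + (y - x₀) ∈ window N x₀ r := by
    refine mem_window.mpr ⟨translate_mem_grid hPI
      (mem_window.mpr ⟨hx'.1, hx'.2.trans hδh⟩) hy'.2, ?_⟩
    have h1 : pos N (x + (y - x₀)) - pos N x₀ =
        (pos N (x + (y - x₀)) - pos N y) + (pos N y - pos N x₀) := by abel
    rw [h1, pos_translate_sub']
    exact (norm_add_le _ _).trans ((add_le_add hx'.2 hy'.2).trans hr)
  refine (hf _ hp _ (mem_window.mpr ⟨hy'.1, hy'.2.trans (by linarith)⟩)).trans ?_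
  rw [pos_translate_sub']
  have := hx'.2
  gcongr

theorem tendsto_natCast_sq_atTop : Tendsto (fun N : ℕ => (N : ℝ) ^ 2) atTop atTop :=
  (tendsto_pow_atTop two_ne_zero).comp tendsto_natCast_atTop_atTop

theorem tendsto_rpow_neg_mul_log {G : ℝ} (hG : 0 < G) :
    Tendsto (fun n : ℝ => n ^ (-G) * Real.log n) atTop (𝓝 0) := by
  refine (isLittleO_log_rpow_atTop hG).tendsto_div_nhds_zero.congr' ?_
  filter_upwards [eventually_gt_atTop 0] with n hn
  rw [Real.rpow_neg hn.le, div_eq_inv_mul]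

/-- The size conditions needed for the finite-sample risk bound hold eventually. -/
theorem eventually_scales {G σ α γ c₁ c₃ c₄ : ℝ} (hG0 : 0 < G) (hc₁ : 0 < c₁) (c₂ : ℝ)
    (hc₃ : 0 < c₃) (hc₄ : 0 < c₄) :
    ∀ᶠ n : ℝ in atTop, 3 ≤ n ∧ 4 ≤ c₃ * n ^ G ∧ 4 ≤ c₄ * n ^ G ∧
      n ^ (-G) * Real.log n ≤ 1 ∧
      4 * (6 / c₃ * (n ^ (-G) * Real.log n)) * (2 * σ ^ 2) ≤ 1 / 2 ∧
      (α < γ → c₄ + c₂ ≤ c₁ * n ^ (γ - α)) := by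
  have hR := tendsto_rpow_neg_mul_log hG0
  have hX := tendsto_rpow_atTop hG0
  have h5 : Tendsto (fun n : ℝ => 4 * (6 / c₃ * (n ^ (-G) * Real.log n)) * (2 * σ ^ 2)) atTop
      (𝓝 (4 * (6 / c₃ * 0) * (2 * σ ^ 2))) := ((hR.const_mul _).const_mul _).mul_const _
  rw [mul_zero, mul_zero, zero_mul] at h5
  have h6 : ∀ᶠ n : ℝ in atTop, α < γ → c₄ + c₂ ≤ c₁ * n ^ (γ - α) := by
    by_cases hαγ' : α < γ
    · filter_upwards [((tendsto_rpow_atTop (sub_pos.mpr hαγ')).const_mul_atTop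
        hc₁).eventually_ge_atTop (c₄ + c₂)] with n hn _ using hn
    · exact Eventually.of_forall fun n hn => absurd hn hαγ'
  filter_upwards [eventually_ge_atTop 3, (hX.const_mul_atTop hc₃).eventually_ge_atTop 4,
    (hX.const_mul_atTop hc₄).eventually_ge_atTop 4, hR.eventually_le_const one_pos,
    h5.eventually_le_const (by norm_num : (0 : ℝ) < 1 / 2), h6] with n h1 h2 h3 h4 h5 h6
  exact ⟨h1, h2, h3, h4, h5, h6⟩

/-- The terms of the finite-sample risk bound in units of the rate `R`. -/
theorem risk_bound_le {σ κ M t b t₁ b₁ v₁ c₄ d₃ d₄ u R X n : ℝ} (hσ : 0 < σ) (hc₄ : 0 < c₄)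
    (hκ : 0 ≤ κ) (ht : 0 ≤ t) (hu : 0 < u) (huR : u ≤ R) (hR1 : R ≤ 1)
    (hXu : X * u = 1) (htR : t ≤ t₁ * R) (hbad : 1 / n ≤ R)
    (hb : b = (t + 2 * (d₄ * u) ^ 2) / (√2 * σ)) (hb₁ : b₁ = (t₁ + 2 * d₄ ^ 2) / (√2 * σ))
    (hv₁ : v₁ = b₁ ^ 2 + 16 * σ ^ 2 / c₄ ^ 2) :
    2 * ((4 * κ * (1 + 2 * (√2 * σ)) + M ^ 2) * √(b ^ 2 + σ ^ 2 / ((c₄ * X) ^ 2 / 16)) +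
        (4 * κ * t + 8 * (d₃ * u) ^ 2) + (b ^ 2 + σ ^ 2 / ((c₄ * X) ^ 2 / 16)) +
        (M ^ 2 + σ ^ 2) * (2 / n)) ≤
      2 * ((4 * κ * (1 + 2 * (√2 * σ)) + M ^ 2) * √v₁ + (4 * κ * t₁ + 8 * d₃ ^ 2) + v₁ +
        (M ^ 2 + σ ^ 2) * 2) * R := by
  have hR0 : 0 < R := hu.trans_le huR
  -- Squares of `u` and `R` are of lower order because `u ≤ R ≤ 1`; only `t` and the square root of
  -- the objective are treated at order `R` itself.
  have hu2R : u ^ 2 ≤ R := by nlinarith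
  have hb0 : 0 ≤ b := by rw [hb]; positivity
  have hv₁0 : 0 ≤ v₁ := by rw [hv₁]; positivity
  have hbR : b ≤ b₁ * R := by
    rw [hb, hb₁, div_mul_eq_mul_div]
    gcongr
    calc t + 2 * (d₄ * u) ^ 2 = t + 2 * d₄ ^ 2 * u ^ 2 := by ring
      _ ≤ t₁ * R + 2 * d₄ ^ 2 * R := by gcongr
      _ = _ := by ring
  have hvar : σ ^ 2 / ((c₄ * X) ^ 2 / 16) ≤ 16 * σ ^ 2 / c₄ ^ 2 * R ^ 2 := by
    have : σ ^ 2 / ((c₄ * X) ^ 2 / 16) = 16 * σ ^ 2 / c₄ ^ 2 * u ^ 2 := by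
      rw [eq_inv_of_mul_eq_one_left hXu]
      field_simp
    rw [this]
    gcongr
  have hobj : b ^ 2 + σ ^ 2 / ((c₄ * X) ^ 2 / 16) ≤ v₁ * R ^ 2 := by
    calc _ ≤ (b₁ * R) ^ 2 + 16 * σ ^ 2 / c₄ ^ 2 * R ^ 2 := by gcongr
      _ = _ := by rw [hv₁]; ring
  have hsqrt : √(b ^ 2 + σ ^ 2 / ((c₄ * X) ^ 2 / 16)) ≤ √v₁ * R := by
    refine (Real.sqrt_le_sqrt hobj).trans (le_of_eq ?_)
    rw [Real.sqrt_mul hv₁0, Real.sqrt_sq hR0.le]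
  have hobj' : b ^ 2 + σ ^ 2 / ((c₄ * X) ^ 2 / 16) ≤ v₁ * R :=
    hobj.trans (by gcongr; nlinarith)
  have hd : 8 * (d₃ * u) ^ 2 ≤ 8 * d₃ ^ 2 * R := by
    calc 8 * (d₃ * u) ^ 2 = 8 * d₃ ^ 2 * u ^ 2 := by ring
      _ ≤ _ := by gcongr
  have hn : 2 / n ≤ 2 * R := by
    rw [show 2 / n = 2 * (1 / n) by ring]
    gcongr
  rw [mul_assoc 2]
  gcongr
  calc _ ≤ (4 * κ * (1 + 2 * (√2 * σ)) + M ^ 2) * (√v₁ * R) +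
        (4 * κ * (t₁ * R) + 8 * d₃ ^ 2 * R) + v₁ * R + (M ^ 2 + σ ^ 2) * (2 * R) := by gcongr
    _ = _ := by ring

end OWF

end

/-! ### Choice of constants and conclusion. -/

open OWF Filter Topology in
theorem theorem4 (β L σ c₁ c₂ : ℝ) (hβ : 0 < β) (hL : 0 < L) (hσ : 0 < σ)
    (hc₁ : 0 < c₁) (hc₂ : 0 < c₂) :
    ∃ C : ℝ, 0 < C ∧
      ∀ α : ℝ, 0 < α → α ≤ 1 / (2 * β + 2) →
        ∃ N₀ : ℕ, ∀ N : ℕ, N₀ ≤ N →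
          ∀ n h η : ℝ, n = (N : ℝ) ^ 2 → h = c₁ * n ^ (-α) →
            η = c₂ * n ^ (-(1 / (2 * β + 2))) →
          ∀ x₀ ∈ OWF.grid N, OWF.PatchesInside N x₀ h η →
          ∀ f : ℝ × ℝ → ℝ,
            OWF.HolderOnPixels N f β L (OWF.window N x₀ h) →
            (α < 1 / (2 * β + 2) ∨ c₂ < c₁ ∨
              OWF.HolderOnPixels N f β L (OWF.window N x₀ (h + η))) →
          ∀ (Ω : Type*) [MeasurableSpace Ω] (μ : Measure Ω) [IsProbabilityMeasure μ]
            (ε : ℤ × ℤ → Ω → ℝ), OWF.IsGaussianNoise N σ ε μ →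
            Integrable (fun ω =>
              (OWF.splitFilter N σ h η (OWF.observe N f ε ω) x₀ - f (OWF.pos N x₀)) ^ 2) μ ∧
            ∫ ω, (OWF.splitFilter N σ h η (OWF.observe N f ε ω) x₀ - f (OWF.pos N x₀)) ^ 2 ∂μ
              ≤ C * (n ^ (-(β / (2 * β + 2))) * Real.log n) := by
  set γ := 1 / (2 * β + 2) with hγ
  set G := β / (2 * β + 2) with hG
  have hγ0 : 0 < γ := by positivity
  have hG0 : 0 < G := by positivity
  have hγG : 1 / 2 - γ = G := by rw [hγ, hG]; field_simp; ring
  have hγβ : γ * β = G := by rw [hγ, hG]; ring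
  have hG1 : G ≤ 1 := by linarith
  clear_value γ G
  obtain ⟨c₃, hc₃, hc₃₁, hc₃₂⟩ : ∃ c₃, 0 < c₃ ∧ c₃ ≤ c₁ ∧ c₃ ≤ c₂ :=
    ⟨min c₁ c₂, lt_min hc₁ hc₂, min_le_left _ _, min_le_right _ _⟩
  -- `c₄` sets the radius `δ` of the near points. If `c₂ < c₁`, it is small enough that their
  -- patches stay in the search window, even when `α = γ`.
  obtain ⟨c₄, hc₄, hc₄₁, hc₄₂, hc₄₃⟩ :
      ∃ c₄, 0 < c₄ ∧ c₄ ≤ c₁ ∧ c₄ ≤ c₂ ∧ (c₂ < c₁ → c₄ + c₂ ≤ c₁) := by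
    by_cases hc : c₂ < c₁
    · exact ⟨min c₂ (c₁ - c₂), lt_min hc₂ (by linarith), (min_le_left _ _).trans hc.le,
        min_le_left _ _, fun _ => by linarith [min_le_right c₂ (c₁ - c₂)]⟩
    · exact ⟨min c₁ c₂, lt_min hc₁ hc₂, min_le_left _ _, min_le_right _ _, fun h => absurd h hc⟩
  -- `144 = 9 · 16`, from the patch size bound `(3 η N)²` and the count `(r N)² / 16`.
  set κ := 144 * (c₂ / c₃) ^ 2 with hκ
  set M := L * c₁ ^ β with hM
  set t₁ := (4 * (2 * σ ^ 2) ^ 2 + 1) * (6 / c₃) with ht₁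
  set b₁ := (t₁ + 2 * (L * c₄ ^ β) ^ 2) / (√2 * σ) with hb₁
  set v₁ := b₁ ^ 2 + 16 * σ ^ 2 / c₄ ^ 2 with hv₁
  have hM0 : 0 < M := by positivity
  have ht₁0 : 0 < t₁ := by positivity
  have hb₁0 : 0 < b₁ := by positivity
  have hv₁0 : 0 < v₁ := by positivity
  have hκ0 : 0 < κ := by positivity
  clear_value κ M t₁ b₁ v₁
  refine ⟨2 * ((4 * κ * (1 + 2 * (√2 * σ)) + M ^ 2) * √v₁ + (4 * κ * t₁ + 8 * (L * c₃ ^ β) ^ 2) +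
    v₁ + (M ^ 2 + σ ^ 2) * 2), by positivity, fun α hα hαγ => ?_⟩
  obtain ⟨N₀, hN₀⟩ := eventually_atTop.mp
    (tendsto_natCast_sq_atTop.eventually
      (eventually_scales (σ := σ) (α := α) (γ := γ) hG0 hc₁ c₂ hc₃ hc₄))
  refine ⟨N₀, fun N hN n h η hn hh hη x₀ hx₀ hPI f hf hcase Ω _ μ _ ε hε => ?_⟩
  obtain ⟨hn3, hrN, hδN, hR1, hθR, hsmall⟩ := hN₀ N hN
  rw [← hn] at hn3 hrN hδN hR1 hθR hsmall
  have hn0 : 0 < n := by linarith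
  have hn1 : 1 ≤ n := by linarith
  have hNpos : 0 < N := by
    rcases Nat.eq_zero_or_pos N with h0 | h0
    · rw [h0] at hn; norm_num at hn; linarith
    · exact h0
  have hNsqrt : (N : ℝ) = n ^ (1 / 2 : ℝ) := by
    rw [← Real.sqrt_eq_rpow, hn, Real.sqrt_sq (Nat.cast_nonneg N)]
  have hscale : ∀ c : ℝ, c * n ^ (-γ) * N = c * n ^ G := fun c => by
    rw [hNsqrt, mul_assoc, ← Real.rpow_add hn0, ← hγG]
    congr 2
    ring
  set u := n ^ (-G) with hu
  set ℓ := Real.log n with hℓ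
  set R := u * ℓ with hR
  have hu0 : 0 < u := Real.rpow_pos_of_pos hn0 _
  have hu1 : u ≤ 1 := Real.rpow_le_one_of_one_le_of_nonpos hn1 (by linarith)
  have hXu : n ^ G * u = 1 := by rw [hu, ← Real.rpow_add hn0, add_neg_cancel, Real.rpow_zero]
  have hℓ1 : 1 ≤ ℓ := by
    rw [hℓ, Real.le_log_iff_exp_le hn0]
    linarith [Real.exp_one_lt_d9]
  have huR : u ≤ R := le_mul_of_one_le_right hu0.le hℓ1
  have hR0 : 0 < R := by positivity
  have hsℓ : √ℓ ≤ ℓ := Real.sqrt_le_iff.mpr ⟨by linarith, by nlinarith⟩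
  clear_value R u ℓ
  have hsℓ0 : 0 < √ℓ := Real.sqrt_pos.mpr (by linarith)
  have hrpow : ∀ c : ℝ, 0 < c → (c * n ^ (-γ)) ^ β = c ^ β * u := fun c hc => by
    rw [Real.mul_rpow hc.le (Real.rpow_nonneg hn0.le _), ← Real.rpow_mul hn0.le, neg_mul, hγβ, hu]
  have hγα : n ^ (-γ) ≤ n ^ (-α) := Real.rpow_le_rpow_of_exponent_le hn1 (by linarith)
  have hnγ0 : 0 < n ^ (-γ) := Real.rpow_pos_of_pos hn0 _
  have hle_h : ∀ c, 0 < c → c ≤ c₁ → c * n ^ (-γ) ≤ h := fun c hc hcc => by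
    rw [hh]; gcongr
  have hle_η : ∀ c, c ≤ c₂ → c * n ^ (-γ) ≤ η := fun c hcc => by
    rw [hη]; gcongr
  have hh0 : 0 ≤ h := by rw [hh]; positivity
  have hMh : L * h ^ β ≤ M := by
    rw [hM]
    gcongr
    rw [hh]
    exact mul_le_of_le_one_right hc₁.le
      (Real.rpow_le_one_of_one_le_of_nonpos hn1 (by linarith))
  -- With this choice `θ² (r N)² / 16 = (36 / 16) ln n`, which exceeds the `2 ln n` needed in the
  -- union bound.
  set θ := 6 / c₃ * (u * √ℓ) with hθ
  have hθ0 : 0 < θ := by positivity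
  clear_value θ
  have hθle : θ ≤ 6 / c₃ * R := by rw [hθ, hR]; gcongr
  set t := (4 * (2 * σ ^ 2) ^ 2 + 1) * θ with ht
  set b := (t + 2 * (L * (c₄ * n ^ (-γ)) ^ β) ^ 2) / (√2 * σ) with hb
  have hnear : ∀ x ∈ searchEven N x₀ (c₄ * n ^ (-γ)), ∀ y ∈ patchOdd N x₀ x₀ η,
      |f (pos N (x + (y - x₀))) - f (pos N y)| ≤ L * (c₄ * n ^ (-γ)) ^ β := by
    intro x hx y hy
    have hδ0 : 0 ≤ c₄ * n ^ (-γ) := by positivity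
    -- Patches of near points reach out to `δ + η`: for `α < γ` the search window eventually
    -- contains them, and in the borderline case one of the two extra assumptions is needed.
    have hin : (c₄ + c₂) * n ^ (-γ) ≤ h ∨ HolderOnPixels N f β L (window N x₀ (h + η)) := by
      rcases hcase with hc | hc | hc
      · left
        calc (c₄ + c₂) * n ^ (-γ) ≤ c₁ * n ^ (γ - α) * n ^ (-γ) := by
              gcongr
              exact hsmall hc
          _ = h := by
            rw [hh, mul_assoc, ← Real.rpow_add hn0]
            congr 2
            ring
      · exact Or.inl (hle_h _ (by positivity) (hc₄₃ hc))
      · exact Or.inr hc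
    rcases hin with hc | hc
    · refine abs_translate_sub_le hL.le hβ.le hPI hδ0 (hle_h _ hc₄ hc₄₁) ?_ hf hx hy
      rw [hη]
      linarith
    · exact abs_translate_sub_le hL.le hβ.le hPI hδ0 (hle_h _ hc₄ hc₄₁)
        (add_le_add_left (hle_h _ hc₄ hc₄₁) η) hc hx hy
  obtain ⟨ε', hmeas, hε', hae⟩ := hε.exists_measurable
  have hae2 : (fun ω => (splitFilter N σ h η (observe N f ε ω) x₀ - f (pos N x₀)) ^ 2) =ᵐ[μ]
      fun ω => (splitFilter N σ h η (observe N f ε' ω) x₀ - f (pos N x₀)) ^ 2 := by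
    filter_upwards [hae] with ω hω
    have : observe N f ε ω = observe N f ε' ω := funext fun p => by rw [observe, observe, hω p]
    rw [this]
  obtain ⟨hint, hrisk⟩ := integral_sq_error_le_of_measurable (r := c₃ * n ^ (-γ))
    (δ := c₄ * n ^ (-γ)) (κ := κ) (M := M) (θ := θ) (t := t) (b := b) hNpos hL hβ hσ hx₀ hPI hh0 hf
    (hle_h _ hc₃ hc₃₁) (hle_η _ hc₃₂) (by rwa [hscale]) (hle_h _ hc₄ hc₄₁) (hle_η _ hc₄₂)
    (by rwa [hscale])
    (by
      rw [hη, hscale, hscale, hκ]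
      refine le_of_eq ?_
      field_simp
      ring)
    hMh hnear hθ0
    (le_trans (by gcongr) hθR)
    (by
      rw [← hn, hscale, hθ, ← hℓ]
      have : (6 / c₃ * (u * √ℓ)) ^ 2 * ((c₃ * n ^ G) ^ 2 / 16) = 36 / 16 * (n ^ G * u) ^ 2 * √ℓ ^ 2 := by
        field_simp
        ring
      rw [this, hXu, Real.sq_sqrt (by linarith)]
      linarith)
    ht hb hmeas hε'
  refine ⟨hint.congr hae2.symm, (integral_congr_ae hae2).trans_le (hrisk.trans ?_)⟩
  rw [hscale, hrpow _ hc₃, ← hn, ← mul_assoc L]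
  have htR : t ≤ t₁ * R := by
    calc t ≤ (4 * (2 * σ ^ 2) ^ 2 + 1) * (6 / c₃ * R) := by rw [ht]; gcongr
      _ = t₁ * R := by rw [ht₁]; ring
  have hbad : 1 / n ≤ R := by
    refine le_trans ?_ huR
    rw [one_div, ← Real.rpow_neg_one, hu]
    exact Real.rpow_le_rpow_of_exponent_le hn1 (by linarith)
  refine risk_bound_le hσ hc₄ hκ0.le (by positivity) hu0 huR hR1 hXu htR hbad ?_ hb₁ hv₁
  rw [hb, hrpow _ hc₄, mul_assoc L]
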